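/- For $b=(b_1,b_2,b_3,b_4)\in\mathbb C^4$ let $$u_4(b)=4-b_1^2-b_2^2-b_3^2-b_4^2-b_1b_2b_3b_4+(b_1b_2+b_3b_4)x_1+(b_1b_3+b_2b_4)x_2+(b_2b_3+b_1b_4)x_3-x_1^2-x_2^2-x_3^2-x_1x_2x_3\in\mathbb C[x_1,x_2,x_3],$$ and let $M_b=\operatorname{Spec}\mathbb C[x_1,x_2,x_3]/(u_4(b))\subset\mathbb C^3$ be the relative $\mathrm{SL}(2,\mathbb C)$-representation variety of the four-holed sphere with boundary traces $b$. Let $\psi_4(b)=\Delta(b)^2\prod_{i=1}^4(b_i^2-4)$, where $$\Delta(b)=\sum_i b_i^4-2\sum_{i<j}b_i^2b_j^2+8b_1b_2b_3b_4+\sum_{i<j<k}b_i^2b_j^2b_k^2-b_1b_2b_3b_4\sum_i b_i^2 .$$ Let $\Omega^i$ be the module of algebraic $i$-forms on $\mathbb C^3$, let $I=(u_4(b))$, let $\Omega^i_{M_b}=\Omega^i/(I\Omega^i+dI\wedge\Omega^{i-1})$ with the induced exterior derivative $d_i:\Omega^i_{M_b}\to\Omega^{i+1}_{M_b}$, and let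 $H^2=\ker d_2/\operatorname{im}d_1$ be the second algebraic de Rham cohomology of $M_b$. **Theorem 7.3.** For every $b\in\mathbb C^4$, the variety $M_b$ is smooth over $\mathbb C$ if and only if $\psi_4(b)\neq 0$. If $M_b$ is smooth, then $\dim_{\mathbb C}H^2=5$, and the classes of $$x_1\,dx_2\wedge dx_3,\quad x_1^2\,dx_2\wedge dx_3,\quad x_2x_1\,dx_2\wedge dx_3,\quad x_3x_1\,dx_2\wedge dx_3,\quad x_1^3\,dx_2\wedge dx_3$$ form a $\mathbb C$-basis of $H^2$. -/

import Mathlib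

open MvPolynomial

noncomputable section

/-! # The algebraic de Rham complex of an affine variety `U = V(I)` in `ℂⁿ` -/

/-- Algebraic differential `i`-forms on `ℂⁿ`: alternating `i`-linear forms on the constant vector
fields `ℂⁿ` with values in the coordinate ring `𝒪 = ℂ[x₁, …, xₙ]`. This is the free `𝒪`-module on
the forms `dx_K = ⋀_{j ∈ K} dx_j`, `|K| = i`. -/
abbrev PolyForm (n i : ℕ) : Type :=
  (Fin n → ℂ) [⋀^Fin i]→ₗ[ℂ] MvPolynomial (Fin n) ℂ

instance polyForm_isScalarTower (n i : ℕ) :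
    IsScalarTower ℂ (MvPolynomial (Fin n) ℂ) (PolyForm n i) where
  smul_assoc c f ω := by
    ext1 v
    exact smul_assoc c f (ω v)

/-- The directional derivative `∂_v = ∑ⱼ vⱼ ∂/∂xⱼ` on `ℂ[x₁, …, xₙ]`, linear in the constant vector
field `v`. -/
def dirDeriv (n : ℕ) :
    (Fin n → ℂ) →ₗ[ℂ] MvPolynomial (Fin n) ℂ →ₗ[ℂ] MvPolynomial (Fin n) ℂ :=
  ∑ j, (LinearMap.proj j).smulRight
    ((pderiv j : Derivation ℂ (MvPolynomial (Fin n) ℂ) (MvPolynomial (Fin n) ℂ)) :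
      MvPolynomial (Fin n) ℂ →ₗ[ℂ] MvPolynomial (Fin n) ℂ)

/-- `v ↦ ∂_v ω`, the coefficientwise derivative of the form `ω` along constant vector fields. -/
def formDeriv (n i : ℕ) : PolyForm n i →ₗ[ℂ] (Fin n → ℂ) →ₗ[ℂ] PolyForm n i where
  toFun ω :=
    { toFun := fun v => (dirDeriv n v).compAlternatingMap ω
      map_add' := fun v w => by ext; simp
      map_smul' := fun c v => by ext; simp }
  map_add' ω η := by ext; simp
  map_smul' c ω := by ext; simp

/-- The exterior derivative
`dω(v₀, …, vᵢ) = ∑ᵣ (-1)ʳ ∂_{vᵣ} (ω(v₀, …, v̂ᵣ, …, vᵢ))` on algebraic forms on `ℂⁿ`. -/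
def polyExtDeriv (n i : ℕ) : PolyForm n i →ₗ[ℂ] PolyForm n (i + 1) :=
  (AlternatingMap.alternatizeUncurryFinLM (n := i)) ∘ₗ formDeriv n i

/-- The wedge product `df ∧ ω`:
`(df ∧ ω)(v₀, …, vᵢ) = ∑ᵣ (-1)ʳ (∂_{vᵣ} f) · ω(v₀, …, v̂ᵣ, …, vᵢ)`. -/
def dWedge {n i : ℕ} (f : MvPolynomial (Fin n) ℂ) (ω : PolyForm n i) : PolyForm n (i + 1) :=
  AlternatingMap.alternatizeUncurryFin
    { toFun := fun v => dirDeriv n v f • ω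
      map_add' := fun v w => by simp [add_smul]
      map_smul' := fun c v => by simp [smul_assoc] }

/-- The form `dx_{k₁} ∧ ⋯ ∧ dx_{kᵢ}`, whose value on `(v₁, …, vᵢ)` is the determinant of the matrix
with entries `(v_r)_{k_s}`. -/
def dxForm {n i : ℕ} (k : Fin i → Fin n) : PolyForm n i :=
  (Algebra.linearMap ℂ (MvPolynomial (Fin n) ℂ)).compAlternatingMap
    ((Matrix.detRowAlternating (n := Fin i) (R := ℂ)).compLinearMap (LinearMap.funLeft ℂ ℂ k))

theorem dxForm_apply {n i : ℕ} (k : Fin i → Fin n) (v : Fin i → Fin n → ℂ) :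
    (dxForm k : PolyForm n i) v = C (Matrix.det (Matrix.of fun r s => v r (k s))) := rfl

theorem polyExtDeriv_apply {n i : ℕ} (ω : PolyForm n i) (v : Fin (i + 1) → Fin n → ℂ) :
    polyExtDeriv n i ω v =
      ∑ r : Fin (i + 1), (-1 : ℤ) ^ (r : ℕ) • dirDeriv n (v r) (ω (r.removeNth v)) := by
  simp [polyExtDeriv, formDeriv, AlternatingMap.alternatizeUncurryFin_apply]

theorem dWedge_apply {n i : ℕ} (f : MvPolynomial (Fin n) ℂ) (ω : PolyForm n i)
    (v : Fin (i + 1) → Fin n → ℂ) :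
    dWedge f ω v =
      ∑ r : Fin (i + 1), (-1 : ℤ) ^ (r : ℕ) • (dirDeriv n (v r) f * ω (r.removeNth v)) := by
  simp [dWedge, AlternatingMap.alternatizeUncurryFin_apply]

theorem dirDeriv_apply {n : ℕ} (v : Fin n → ℂ) (f : MvPolynomial (Fin n) ℂ) :
    dirDeriv n v f = ∑ j, v j • pderiv j f := by
  simp [dirDeriv]

theorem dirDeriv_mul {n : ℕ} (v : Fin n → ℂ) (f g : MvPolynomial (Fin n) ℂ) :
    dirDeriv n v (f * g) = dirDeriv n v f * g + f * dirDeriv n v g := by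
  simp only [dirDeriv_apply, Derivation.leibniz, smul_add, Finset.sum_add_distrib,
    Finset.sum_mul, Finset.mul_sum, smul_eq_mul]
  rw [add_comm]
  congr 1 <;> refine Finset.sum_congr rfl fun j _ => ?_
  · rw [mul_comm g, smul_mul_assoc]
  · rw [mul_smul_comm]

theorem dirDeriv_comm {n : ℕ} (v w : Fin n → ℂ) (f : MvPolynomial (Fin n) ℂ) :
    dirDeriv n v (dirDeriv n w f) = dirDeriv n w (dirDeriv n v f) := by
  have hp : ∀ j k : Fin n, pderiv j (pderiv k f) = pderiv k (pderiv j f) := fun j k => by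
    have h : ⁅(pderiv j : Derivation ℂ (MvPolynomial (Fin n) ℂ) (MvPolynomial (Fin n) ℂ)),
        (pderiv k : Derivation ℂ (MvPolynomial (Fin n) ℂ) (MvPolynomial (Fin n) ℂ))⁆ = 0 := by
      refine MvPolynomial.derivation_ext fun l => ?_
      rw [Derivation.commutator_apply, pderiv_X, pderiv_X, Pi.single_apply, Pi.single_apply]
      split_ifs <;> simp
    have := congrArg (fun D => D f) h
    simpa [Derivation.commutator_apply, sub_eq_zero] using this
  simp only [dirDeriv_apply, map_sum, map_smul, Finset.smul_sum, smul_smul]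
  rw [Finset.sum_comm]
  refine Finset.sum_congr rfl fun j _ => Finset.sum_congr rfl fun k _ => ?_
  rw [hp, mul_comm]

/-- The Leibniz rule `d(fω) = df ∧ ω + f dω`. -/
theorem polyExtDeriv_smul {n i : ℕ} (f : MvPolynomial (Fin n) ℂ) (ω : PolyForm n i) :
    polyExtDeriv n i (f • ω) = dWedge f ω + f • polyExtDeriv n i ω := by
  ext1 v
  simp only [AlternatingMap.add_apply, AlternatingMap.smul_apply, polyExtDeriv_apply, dWedge_apply,
    smul_eq_mul, dirDeriv_mul, smul_add, Finset.sum_add_distrib, Finset.mul_sum, mul_smul_comm]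

/-- `d ∘ d = 0`. -/
theorem polyExtDeriv_polyExtDeriv {n i : ℕ} (ω : PolyForm n i) :
    polyExtDeriv n (i + 1) (polyExtDeriv n i ω) = 0 := by
  have hsymm : ∀ v w, (formDeriv n i ∘ₗ formDeriv n i ω) v w =
      (formDeriv n i ∘ₗ formDeriv n i ω) w v := fun v w => by
    ext1 u
    exact dirDeriv_comm w v (ω u)
  have h := AlternatingMap.alternatizeUncurryFin_alternatizeUncurryFinLM_comp_of_symmetric hsymm
  have h2 : formDeriv n (i + 1) (polyExtDeriv n i ω) =
      AlternatingMap.alternatizeUncurryFinLM ∘ₗ (formDeriv n i ∘ₗ formDeriv n i ω) := by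
    refine LinearMap.ext fun v => AlternatingMap.ext fun u => ?_
    change dirDeriv n v (polyExtDeriv n i ω u) = polyExtDeriv n i (formDeriv n i ω v) u
    rw [polyExtDeriv_apply, polyExtDeriv_apply, map_sum]
    refine Finset.sum_congr rfl fun r _ => ?_
    rw [map_zsmul, dirDeriv_comm]
    rfl
  change AlternatingMap.alternatizeUncurryFin (formDeriv n (i + 1) (polyExtDeriv n i ω)) = 0
  rw [h2, h]

theorem dWedge_eq {n i : ℕ} (f : MvPolynomial (Fin n) ℂ) (ω : PolyForm n i) :
    dWedge f ω = polyExtDeriv n i (f • ω) - f • polyExtDeriv n i ω := by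
  rw [polyExtDeriv_smul, add_sub_cancel_right]

theorem smul_dWedge {n i : ℕ} (a f : MvPolynomial (Fin n) ℂ) (ω : PolyForm n i) :
    a • dWedge f ω = dWedge f (a • ω) := by
  ext1 v
  simp only [AlternatingMap.smul_apply, dWedge_apply, smul_eq_mul, Finset.mul_sum, mul_smul_comm]
  refine Finset.sum_congr rfl fun r _ => ?_
  rw [mul_left_comm]

/-- `d(df ∧ ω) = - df ∧ dω`. -/
theorem polyExtDeriv_dWedge {n i : ℕ} (f : MvPolynomial (Fin n) ℂ) (ω : PolyForm n i) :
    polyExtDeriv n (i + 1) (dWedge f ω) = -dWedge f (polyExtDeriv n i ω) := by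
  rw [dWedge_eq f ω, map_sub, polyExtDeriv_polyExtDeriv, polyExtDeriv_smul,
    polyExtDeriv_polyExtDeriv, smul_zero, add_zero, zero_sub]

/-- The forms that vanish on `U = V(I)`: `IΩⁱ` for `i = 0` and `IΩⁱ + dI ∧ Ωⁱ⁻¹` for `i > 0`. -/
def vanishingForms {n : ℕ} (I : Ideal (MvPolynomial (Fin n) ℂ)) :
    (i : ℕ) → Submodule (MvPolynomial (Fin n) ℂ) (PolyForm n i)
  | 0 => Submodule.span _ {θ | ∃ f ∈ I, ∃ ω : PolyForm n 0, θ = f • ω}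
  | i + 1 => Submodule.span _ {θ | ∃ f ∈ I, ∃ ω : PolyForm n (i + 1), θ = f • ω} ⊔
      Submodule.span _ {θ | ∃ f ∈ I, ∃ η : PolyForm n i, θ = dWedge f η}

/-- `Ωⁱ_U = Ωⁱ / (IΩⁱ + dI ∧ Ωⁱ⁻¹)`, the algebraic `i`-forms on `U = V(I)`, as a `ℂ`-space. -/
abbrev DeRhamForm {n : ℕ} (I : Ideal (MvPolynomial (Fin n) ℂ)) (i : ℕ) : Type :=
  PolyForm n i ⧸ (vanishingForms I i).restrictScalars ℂ

/-- The restriction to `U` of an algebraic form on `ℂⁿ`. -/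
def restrictForm {n : ℕ} (I : Ideal (MvPolynomial (Fin n) ℂ)) (i : ℕ) :
    PolyForm n i →ₗ[ℂ] DeRhamForm I i :=
  ((vanishingForms I i).restrictScalars ℂ).mkQ

theorem smul_mem_vanishingForms {n i : ℕ} {I : Ideal (MvPolynomial (Fin n) ℂ)}
    {f : MvPolynomial (Fin n) ℂ} (hf : f ∈ I) (ω : PolyForm n i) :
    f • ω ∈ vanishingForms I i := by
  cases i with
  | zero => exact Submodule.subset_span ⟨f, hf, ω, rfl⟩
  | succ i => exact Submodule.mem_sup_left (Submodule.subset_span ⟨f, hf, ω, rfl⟩)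

theorem dWedge_mem_vanishingForms {n i : ℕ} {I : Ideal (MvPolynomial (Fin n) ℂ)}
    {f : MvPolynomial (Fin n) ℂ} (hf : f ∈ I) (η : PolyForm n i) :
    dWedge f η ∈ vanishingForms I (i + 1) :=
  Submodule.mem_sup_right (Submodule.subset_span ⟨f, hf, η, rfl⟩)

theorem polyExtDeriv_mem_vanishingForms {n i : ℕ} {I : Ideal (MvPolynomial (Fin n) ℂ)}
    {ω : PolyForm n i} (hω : ω ∈ vanishingForms I i) :
    polyExtDeriv n i ω ∈ vanishingForms I (i + 1) := by
  have h1 : ∀ {j : ℕ} {θ : PolyForm n j},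
      θ ∈ Submodule.span (MvPolynomial (Fin n) ℂ)
        {θ | ∃ f ∈ I, ∃ ω : PolyForm n j, θ = f • ω} →
      ∀ a : MvPolynomial (Fin n) ℂ, polyExtDeriv n j (a • θ) ∈ vanishingForms I (j + 1) := by
    intro j θ hθ
    induction hθ using Submodule.span_induction with
    | mem θ h =>
      obtain ⟨f, hf, η, rfl⟩ := h
      intro a
      rw [smul_comm, polyExtDeriv_smul]
      exact add_mem (dWedge_mem_vanishingForms hf _) (smul_mem_vanishingForms hf _)
    | zero => intro a; simp
    | add x y _ _ hx hy => intro a; rw [smul_add, map_add]; exact add_mem (hx a) (hy a)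
    | smul c x _ hx => intro a; rw [smul_smul]; exact hx _
  have h2 : ∀ {j : ℕ} {θ : PolyForm n (j + 1)},
      θ ∈ Submodule.span (MvPolynomial (Fin n) ℂ)
        {θ | ∃ f ∈ I, ∃ η : PolyForm n j, θ = dWedge f η} →
      ∀ a : MvPolynomial (Fin n) ℂ,
        polyExtDeriv n (j + 1) (a • θ) ∈ vanishingForms I (j + 1 + 1) := by
    intro j θ hθ
    induction hθ using Submodule.span_induction with
    | mem θ h =>
      obtain ⟨f, hf, η, rfl⟩ := h
      intro a
      rw [smul_dWedge, polyExtDeriv_dWedge]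
      exact neg_mem (dWedge_mem_vanishingForms hf _)
    | zero => intro a; simp
    | add x y _ _ hx hy => intro a; rw [smul_add, map_add]; exact add_mem (hx a) (hy a)
    | smul c x _ hx => intro a; rw [smul_smul]; exact hx _
  cases i with
  | zero => simpa using h1 hω 1
  | succ i =>
    obtain ⟨x, hx, y, hy, rfl⟩ := Submodule.mem_sup.1 hω
    rw [map_add]
    exact add_mem (by simpa using h1 hx 1) (by simpa using h2 hy 1)

/-- The differential `dᵢ : Ωⁱ_U → Ωⁱ⁺¹_U` of the algebraic de Rham complex of `U = V(I)`, induced by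
the exterior derivative on `ℂⁿ`. -/
def deRhamD {n : ℕ} (I : Ideal (MvPolynomial (Fin n) ℂ)) (i : ℕ) :
    DeRhamForm I i →ₗ[ℂ] DeRhamForm I (i + 1) :=
  Submodule.mapQ _ _ (polyExtDeriv n i) fun _ hω => polyExtDeriv_mem_vanishingForms hω

/-- The exact `i`-forms on `U`: the image of `dᵢ₋₁`, and `0` for `i = 0`. -/
def exactForms {n : ℕ} (I : Ideal (MvPolynomial (Fin n) ℂ)) :
    (i : ℕ) → Submodule ℂ (DeRhamForm I i)
  | 0 => ⊥
  | i + 1 => LinearMap.range (deRhamD I i)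

/-- The closed `i`-forms on `U`: the kernel of `dᵢ`. -/
def closedForms {n : ℕ} (I : Ideal (MvPolynomial (Fin n) ℂ)) (i : ℕ) :
    Submodule ℂ (DeRhamForm I i) :=
  LinearMap.ker (deRhamD I i)

/-- The algebraic de Rham cohomology `Hⁱ(U) = ker dᵢ / im dᵢ₋₁` of the affine variety `U = V(I)`. -/
abbrev DeRhamCohomology {n : ℕ} (I : Ideal (MvPolynomial (Fin n) ℂ)) (i : ℕ) : Type :=
  closedForms I i ⧸ (exactForms I i).submoduleOf (closedForms I i)

/-- The cohomology class of a closed form on `U`. -/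
def deRhamClass {n : ℕ} (I : Ideal (MvPolynomial (Fin n) ℂ)) (i : ℕ) :
    closedForms I i →ₗ[ℂ] DeRhamCohomology I i :=
  ((exactForms I i).submoduleOf (closedForms I i)).mkQ

/-! # The representation varieties of the four-holed sphere -/

/-- The cubic polynomial `u₄(b) ∈ ℂ[x₁, x₂, x₃]`, for boundary traces `b = (b₁, b₂, b₃, b₄)`.
The variables `x₁, x₂, x₃` are `X 0, X 1, X 2`. -/
def fourHoledPoly (b : Fin 4 → ℂ) : MvPolynomial (Fin 3) ℂ :=
  C (4 - b 0 ^ 2 - b 1 ^ 2 - b 2 ^ 2 - b 0 * b 1 * b 2 * b 3 - b 3 ^ 2)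
    + C (b 0 * b 1 + b 2 * b 3) * X 0 - X 0 ^ 2
    + C (b 0 * b 2 + b 1 * b 3) * X 1 - X 1 ^ 2
    + C (b 1 * b 2 + b 0 * b 3) * X 2 - X 0 * X 1 * X 2 - X 2 ^ 2

/-- The ideal `L_b = (u₄(b))` defining `M_b` in `ℂ³`. -/
def fourHoledIdeal (b : Fin 4 → ℂ) : Ideal (MvPolynomial (Fin 3) ℂ) :=
  Ideal.span {fourHoledPoly b}

/-- The coordinate ring of `M_b`. -/
abbrev FourHoledRing (b : Fin 4 → ℂ) : Type :=
  MvPolynomial (Fin 3) ℂ ⧸ fourHoledIdeal b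

/-- The symmetric polynomial `Δ`. -/
def fourHoledDelta (y : Fin 4 → ℂ) : ℂ :=
  (y 0 ^ 4 + y 1 ^ 4 + y 2 ^ 4 + y 3 ^ 4)
    - 2 * (y 0 ^ 2 * y 1 ^ 2 + y 0 ^ 2 * y 2 ^ 2 + y 0 ^ 2 * y 3 ^ 2
      + y 1 ^ 2 * y 2 ^ 2 + y 1 ^ 2 * y 3 ^ 2 + y 2 ^ 2 * y 3 ^ 2)
    + 8 * (y 0 * y 1 * y 2 * y 3)
    + (y 0 ^ 2 * y 1 ^ 2 * y 2 ^ 2 + y 0 ^ 2 * y 1 ^ 2 * y 3 ^ 2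
      + y 0 ^ 2 * y 2 ^ 2 * y 3 ^ 2 + y 1 ^ 2 * y 2 ^ 2 * y 3 ^ 2)
    - (y 0 ^ 3 * y 1 * y 2 * y 3 + y 0 * y 1 ^ 3 * y 2 * y 3
      + y 0 * y 1 * y 2 ^ 3 * y 3 + y 0 * y 1 * y 2 * y 3 ^ 3)

/-- The symmetric polynomial `ψ₄ = Δ² ∏ᵢ (yᵢ² - 4)`. -/
def psi4 (y : Fin 4 → ℂ) : ℂ :=
  fourHoledDelta y ^ 2 * ∏ i, (y i ^ 2 - 4)

/-- The 2-forms `1·x₁dx₂₃, x₁·x₁dx₂₃, x₂·x₁dx₂₃, x₃·x₁dx₂₃, x₁²·x₁dx₂₃` on `ℂ³`. -/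
def basisForm : Fin 5 → PolyForm 3 2 :=
  ![(1 : MvPolynomial (Fin 3) ℂ) • ((X 0 : MvPolynomial (Fin 3) ℂ) • dxForm ![1, 2]),
    (X 0 : MvPolynomial (Fin 3) ℂ) • ((X 0 : MvPolynomial (Fin 3) ℂ) • dxForm ![1, 2]),
    (X 1 : MvPolynomial (Fin 3) ℂ) • ((X 0 : MvPolynomial (Fin 3) ℂ) • dxForm ![1, 2]),
    (X 2 : MvPolynomial (Fin 3) ℂ) • ((X 0 : MvPolynomial (Fin 3) ℂ) • dxForm ![1, 2]),
    (X 0 ^ 2 : MvPolynomial (Fin 3) ℂ) • ((X 0 : MvPolynomial (Fin 3) ℂ) • dxForm ![1, 2])]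

end

/-! Write `u` for the cubic and `𝒪 = ℂ[x₁, x₂, x₃]`.

Smoothness. By the infinitesimal splitting criterion and the Nullstellensatz, `M_b` is smooth iff
the surface has no singular point (`smooth_quotient_span_iff`). At a singular point, `x₃` is a
double root of the discriminant of the conic fibration over the `x₃`-line. For boundary traces this
quartic is a product of two quadratics with discriminants `(b₂² - 4)(b₃² - 4)`, `(b₁² - 4)(b₄² - 4)`
and resultant `Δ`, so `ψ₄ = 0`. Conversely, representations with a central boundary holonomy, or
diagonal ones, give explicit singular points.

Cohomology. On a smooth `M_b` every 2-form is closed, and by the Poincaré lemma on `ℂ³` a 2-form is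
exact on `M_b` iff its differential on `ℂ³` is some `d(uη)`. Taking `d` therefore identifies `H²`
with `𝒪` modulo the divergences `div(u h)`, and the five forms go to nonzero multiples of `1, x₁,
x₂, x₃, x₁²`. These must be shown to form a basis of the quotient, which holds for any coefficients
of the cubic.

Spanning is a degree reduction (`exists_basisPoly_add_divMul`). For independence, put `x₁ = v +
v⁻¹`, so that `u` becomes `c(v) - ξη`, and average over the disc bounded by the conic `ξη = c`. If
`m(v)` is the mean of a combination equal to `div(u h)`, integration by parts gives `c m = v dR/dv`
with `R = c² k / (v - v⁻¹)`, where `k` is a weighted mean of `h₁` (`radius_mul_conicMean_divMul`).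
Comparing the poles of `c m` with the zeros forced by `c²` yields `R = 0`, hence `m = 0`, provided
`β² ≠ γ²`. The remaining parameters follow by deforming `β` and using the spanning statement over
`ℂ[τ]`. -/

/-! # Cubic polynomials and their module of divergences -/

section Cubic

variable {k : Type*} [CommRing k]

/-- The cubic `κ + α x₁ + β x₂ + γ x₃ - x₁² - x₂² - x₃² - x₁ x₂ x₃`. -/
noncomputable def cubic (κ α β γ : k) : MvPolynomial (Fin 3) k :=
  C κ + C α * X 0 + C β * X 1 + C γ * X 2 - X 0 ^ 2 - X 1 ^ 2 - X 2 ^ 2 - X 0 * X 1 * X 2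

/-- The divergence of the vector field `u • h`, linear in `h`. -/
noncomputable def divMul (u : MvPolynomial (Fin 3) k) :
    (Fin 3 → MvPolynomial (Fin 3) k) →ₗ[k] MvPolynomial (Fin 3) k :=
  ∑ i, ((pderiv i : Derivation k (MvPolynomial (Fin 3) k) (MvPolynomial (Fin 3) k)) :
      MvPolynomial (Fin 3) k →ₗ[k] MvPolynomial (Fin 3) k) ∘ₗ LinearMap.mulLeft k u ∘ₗ
      LinearMap.proj i

theorem divMul_apply (u : MvPolynomial (Fin 3) k) (h : Fin 3 → MvPolynomial (Fin 3) k) :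
    divMul u h = ∑ i, pderiv i (u * h i) := by
  simp [divMul]

/-- The divergences of all vector fields divisible by `u`. -/
noncomputable def divSubmodule (u : MvPolynomial (Fin 3) k) :
    Submodule k (MvPolynomial (Fin 3) k) :=
  LinearMap.range (divMul u)

theorem pderiv_mul_mem_divSubmodule (u : MvPolynomial (Fin 3) k) (i : Fin 3)
    (g : MvPolynomial (Fin 3) k) : pderiv i (u * g) ∈ divSubmodule u := by
  refine ⟨Pi.single i g, ?_⟩
  rw [divMul_apply, Finset.sum_eq_single i]
  · simp
  · intro j _ hj
    simp [Pi.single_eq_of_ne hj]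
  · simp

/-- The five polynomials `1, x₁, x₂, x₃, x₁²`. -/
noncomputable def basisPoly (k : Type*) [CommRing k] : Fin 5 → MvPolynomial (Fin 3) k :=
  ![1, X 0, X 1, X 2, X 0 ^ 2]

/-! ### Reduction to `1, x₁, x₂, x₃, x₁²` modulo divergences -/

section Span

variable (κ α β γ : k)

/-- The submodule spanned by the divergences and the five basis polynomials. -/
noncomputable def reduced : Submodule k (MvPolynomial (Fin 3) k) :=
  divSubmodule (cubic κ α β γ) ⊔ Submodule.span k (Set.range (basisPoly k))

variable {κ α β γ}

/-- Only division by positive integers is needed, so the reduction works over any `ℚ`-algebra. The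
deformation argument for independence applies it over `Polynomial ℂ`. -/
theorem mem_reduced_of_natCast_mul [Algebra ℚ k] {n : ℕ} (hn : n ≠ 0) {p : MvPolynomial (Fin 3) k}
    (h : (n : MvPolynomial (Fin 3) k) * p ∈ reduced κ α β γ) : p ∈ reduced κ α β γ := by
  have h2 := (reduced κ α β γ).smul_mem (algebraMap ℚ k (n : ℚ)⁻¹) h
  rwa [← nsmul_eq_mul, ← Nat.cast_smul_eq_nsmul k, smul_smul, ← map_natCast (algebraMap ℚ k),
    ← map_mul, inv_mul_cancel₀ (by exact_mod_cast hn), map_one, one_smul] at h2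

theorem C_mul_mem_reduced (a : k) {p : MvPolynomial (Fin 3) k} (h : p ∈ reduced κ α β γ) :
    C a * p ∈ reduced κ α β γ := by
  rw [C_mul']
  exact (reduced κ α β γ).smul_mem a h

theorem natCast_mul_mem_reduced (a : ℕ) {p : MvPolynomial (Fin 3) k}
    (h : p ∈ reduced κ α β γ) : (a : MvPolynomial (Fin 3) k) * p ∈ reduced κ α β γ := by
  rw [← nsmul_eq_mul]
  exact nsmul_mem h a

theorem pderiv_mem_reduced (i : Fin 3) (g : MvPolynomial (Fin 3) k) :
    pderiv i (cubic κ α β γ * g) ∈ reduced κ α β γ :=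
  Submodule.mem_sup_left (pderiv_mul_mem_divSubmodule _ i g)

theorem basisPoly_mem_reduced (j : Fin 5) : basisPoly k j ∈ reduced κ α β γ :=
  Submodule.mem_sup_right (Submodule.subset_span ⟨j, rfl⟩)

/-- The monomial `x₁ᵃ x₂ᵇ x₃ᶜ`. -/
noncomputable def mon (k : Type*) [CommRing k] (a b c : ℕ) : MvPolynomial (Fin 3) k :=
  X 0 ^ a * X 1 ^ b * X 2 ^ c

/-- The top-degree term of `∂₁(u x₁ᵃ x₂ᵇ x₃ᶜ)` comes from `-x₁x₂x₃` and equals `-(a + 1) x₁ᵃ x₂ᵇ⁺¹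
x₃ᶜ⁺¹`; all others have smaller degree. -/
theorem mon_mem_reduced_yz [Algebra ℚ k] {a b c : ℕ}
    (h : ∀ a' b' c', a' + b' + c' < a + b + c + 2 → mon k a' b' c' ∈ reduced κ α β γ) :
    mon k a (b + 1) (c + 1) ∈ reduced κ α β γ := by
  refine mem_reduced_of_natCast_mul (n := a + 1) (by omega) ?_
  have hd := pderiv_mem_reduced (κ := κ) (α := α) (β := β) (γ := γ) 0 (mon k a b c)
  -- Terms with coefficient `a` involve `x₁ᵃ⁻¹`; they are absent for `a = 0`.
  rcases a with _ | a
  · convert sub_mem (sub_mem (C_mul_mem_reduced α (h 0 b c (by omega)))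
      (natCast_mul_mem_reduced 2 (h 1 b c (by omega)))) hd using 1
    simp [cubic, mon, pderiv_X]
    ring
  · convert sub_mem (sub_mem (sub_mem (sub_mem (add_mem (add_mem (add_mem
      (C_mul_mem_reduced κ (natCast_mul_mem_reduced (a + 1) (h a b c (by omega))))
      (C_mul_mem_reduced β (natCast_mul_mem_reduced (a + 1) (h a (b + 1) c (by omega)))))
      (C_mul_mem_reduced γ (natCast_mul_mem_reduced (a + 1) (h a b (c + 1) (by omega)))))
      (C_mul_mem_reduced α (natCast_mul_mem_reduced (a + 2) (h (a + 1) b c (by omega)))))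
      (natCast_mul_mem_reduced (a + 1) (h a (b + 2) c (by omega))))
      (natCast_mul_mem_reduced (a + 1) (h a b (c + 2) (by omega))))
      (natCast_mul_mem_reduced (a + 3) (h (a + 2) b c (by omega)))) hd using 1
    simp [cubic, mon, pderiv_X]
    ring

theorem mon_mem_reduced_xz [Algebra ℚ k] {a b c : ℕ}
    (h : ∀ a' b' c', a' + b' + c' < a + b + c + 2 → mon k a' b' c' ∈ reduced κ α β γ) :
    mon k (a + 1) b (c + 1) ∈ reduced κ α β γ := by
  refine mem_reduced_of_natCast_mul (n := b + 1) (by omega) ?_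
  have hd := pderiv_mem_reduced (κ := κ) (α := α) (β := β) (γ := γ) 1 (mon k a b c)
  rcases b with _ | b
  · convert sub_mem (sub_mem (C_mul_mem_reduced β (h a 0 c (by omega)))
      (natCast_mul_mem_reduced 2 (h a 1 c (by omega)))) hd using 1
    simp [cubic, mon, pderiv_X]
    ring
  · convert sub_mem (sub_mem (sub_mem (sub_mem (add_mem (add_mem (add_mem
      (C_mul_mem_reduced κ (natCast_mul_mem_reduced (b + 1) (h a b c (by omega))))
      (C_mul_mem_reduced α (natCast_mul_mem_reduced (b + 1) (h (a + 1) b c (by omega)))))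
      (C_mul_mem_reduced γ (natCast_mul_mem_reduced (b + 1) (h a b (c + 1) (by omega)))))
      (C_mul_mem_reduced β (natCast_mul_mem_reduced (b + 2) (h a (b + 1) c (by omega)))))
      (natCast_mul_mem_reduced (b + 1) (h (a + 2) b c (by omega))))
      (natCast_mul_mem_reduced (b + 1) (h a b (c + 2) (by omega))))
      (natCast_mul_mem_reduced (b + 3) (h a (b + 2) c (by omega)))) hd using 1
    simp [cubic, mon, pderiv_X]
    ring

theorem mon_mem_reduced_xy [Algebra ℚ k] {a b c : ℕ}
    (h : ∀ a' b' c', a' + b' + c' < a + b + c + 2 → mon k a' b' c' ∈ reduced κ α β γ) :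
    mon k (a + 1) (b + 1) c ∈ reduced κ α β γ := by
  refine mem_reduced_of_natCast_mul (n := c + 1) (by omega) ?_
  have hd := pderiv_mem_reduced (κ := κ) (α := α) (β := β) (γ := γ) 2 (mon k a b c)
  rcases c with _ | c
  · convert sub_mem (sub_mem (C_mul_mem_reduced γ (h a b 0 (by omega)))
      (natCast_mul_mem_reduced 2 (h a b 1 (by omega)))) hd using 1
    simp [cubic, mon, pderiv_X]
    ring
  · convert sub_mem (sub_mem (sub_mem (sub_mem (add_mem (add_mem (add_mem
      (C_mul_mem_reduced κ (natCast_mul_mem_reduced (c + 1) (h a b c (by omega))))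
      (C_mul_mem_reduced α (natCast_mul_mem_reduced (c + 1) (h (a + 1) b c (by omega)))))
      (C_mul_mem_reduced β (natCast_mul_mem_reduced (c + 1) (h a (b + 1) c (by omega)))))
      (C_mul_mem_reduced γ (natCast_mul_mem_reduced (c + 2) (h a b (c + 1) (by omega)))))
      (natCast_mul_mem_reduced (c + 1) (h (a + 2) b c (by omega))))
      (natCast_mul_mem_reduced (c + 1) (h a (b + 2) c (by omega))))
      (natCast_mul_mem_reduced (c + 3) (h a b (c + 2) (by omega)))) hd using 1
    simp [cubic, mon, pderiv_X]
    ring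

theorem mon_mem_reduced_of_two_pos [Algebra ℚ k] {a b c : ℕ}
    (h : ∀ a' b' c', a' + b' + c' < a + b + c → mon k a' b' c' ∈ reduced κ α β γ)
    (hpos : 0 < a ∧ 0 < b ∨ 0 < a ∧ 0 < c ∨ 0 < b ∧ 0 < c) :
    mon k a b c ∈ reduced κ α β γ := by
  rcases hpos with ⟨h1, h2⟩ | ⟨h1, h2⟩ | ⟨h1, h2⟩
  · obtain ⟨a, rfl⟩ := Nat.exists_eq_succ_of_ne_zero h1.ne'
    obtain ⟨b, rfl⟩ := Nat.exists_eq_succ_of_ne_zero h2.ne'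
    exact mon_mem_reduced_xy fun a' b' c' h' => h a' b' c' (by omega)
  · obtain ⟨a, rfl⟩ := Nat.exists_eq_succ_of_ne_zero h1.ne'
    obtain ⟨c, rfl⟩ := Nat.exists_eq_succ_of_ne_zero h2.ne'
    exact mon_mem_reduced_xz fun a' b' c' h' => h a' b' c' (by omega)
  · obtain ⟨b, rfl⟩ := Nat.exists_eq_succ_of_ne_zero h1.ne'
    obtain ⟨c, rfl⟩ := Nat.exists_eq_succ_of_ne_zero h2.ne'
    exact mon_mem_reduced_yz fun a' b' c' h' => h a' b' c' (by omega)

/-- `n ∂₂(u x₁ⁿ⁻² x₂) - 2 ∂₁(u x₁ⁿ⁻¹)` reduces `x₁ⁿ` modulo lower degree and mixed monomials. -/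
theorem mon_mem_reduced_x [Algebra ℚ k] {n : ℕ}
    (h : ∀ a b c, a + b + c < n + 3 → mon k a b c ∈ reduced κ α β γ) :
    mon k (n + 3) 0 0 ∈ reduced κ α β γ := by
  have hj : mon k (n + 1) 2 0 ∈ reduced κ α β γ :=
    mon_mem_reduced_of_two_pos (fun a b c h' => h a b c (by omega)) (by omega)
  have hl : mon k (n + 1) 0 2 ∈ reduced κ α β γ :=
    mon_mem_reduced_of_two_pos (fun a b c h' => h a b c (by omega)) (by omega)
  have h1 := pderiv_mem_reduced (κ := κ) (α := α) (β := β) (γ := γ) 0 (mon k (n + 2) 0 0)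
  have h2 := pderiv_mem_reduced (κ := κ) (α := α) (β := β) (γ := γ) 1 (mon k (n + 1) 1 0)
  refine mem_reduced_of_natCast_mul (n := n + 5) (by omega) ?_
  convert sub_mem (add_mem (add_mem (sub_mem (add_mem (add_mem
    (sub_mem (natCast_mul_mem_reduced (n + 3) h2) (natCast_mul_mem_reduced 2 h1))
    (C_mul_mem_reduced κ (natCast_mul_mem_reduced (n + 1) (h (n + 1) 0 0 (by omega)))))
    (C_mul_mem_reduced α (natCast_mul_mem_reduced (n + 3) (h (n + 2) 0 0 (by omega)))))
    (C_mul_mem_reduced β (natCast_mul_mem_reduced 2 (h (n + 1) 1 0 (by omega)))))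
    (C_mul_mem_reduced γ (natCast_mul_mem_reduced (n + 1) (h (n + 1) 0 1 (by omega)))))
    (natCast_mul_mem_reduced (n + 5) hj)) (natCast_mul_mem_reduced (n + 1) hl) using 1
  simp [cubic, mon, pderiv_X]
  ring

/-- With `N = n + 3`, the combination is `N ∂₁(u x₁ x₂ᴺ⁻²) - 2 ∂₂(u x₂ᴺ⁻¹)`: the terms `x₁ x₂ᴺ⁻¹ x₃`
of degree `N + 1` cancel and `x₂ᴺ` keeps the coefficient `N + 2`. The other terms of degree `N` are
mixed, hence already reducible. -/
theorem mon_mem_reduced_y [Algebra ℚ k] {n : ℕ}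
    (h : ∀ a b c, a + b + c < n + 3 → mon k a b c ∈ reduced κ α β γ) :
    mon k 0 (n + 3) 0 ∈ reduced κ α β γ := by
  have hj : mon k 2 (n + 1) 0 ∈ reduced κ α β γ :=
    mon_mem_reduced_of_two_pos (fun a b c h' => h a b c (by omega)) (by omega)
  have hl : mon k 0 (n + 1) 2 ∈ reduced κ α β γ :=
    mon_mem_reduced_of_two_pos (fun a b c h' => h a b c (by omega)) (by omega)
  have h1 := pderiv_mem_reduced (κ := κ) (α := α) (β := β) (γ := γ) 1 (mon k 0 (n + 2) 0)
  have h2 := pderiv_mem_reduced (κ := κ) (α := α) (β := β) (γ := γ) 0 (mon k 1 (n + 1) 0)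
  refine mem_reduced_of_natCast_mul (n := n + 5) (by omega) ?_
  convert sub_mem (add_mem (add_mem (sub_mem (add_mem (add_mem
    (sub_mem (natCast_mul_mem_reduced (n + 3) h2) (natCast_mul_mem_reduced 2 h1))
    (C_mul_mem_reduced κ (natCast_mul_mem_reduced (n + 1) (h 0 (n + 1) 0 (by omega)))))
    (C_mul_mem_reduced β (natCast_mul_mem_reduced (n + 3) (h 0 (n + 2) 0 (by omega)))))
    (C_mul_mem_reduced α (natCast_mul_mem_reduced 2 (h 1 (n + 1) 0 (by omega)))))
    (C_mul_mem_reduced γ (natCast_mul_mem_reduced (n + 1) (h 0 (n + 1) 1 (by omega)))))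
    (natCast_mul_mem_reduced (n + 5) hj)) (natCast_mul_mem_reduced (n + 1) hl) using 1
  simp [cubic, mon, pderiv_X]
  ring

theorem mon_mem_reduced_z [Algebra ℚ k] {n : ℕ}
    (h : ∀ a b c, a + b + c < n + 3 → mon k a b c ∈ reduced κ α β γ) :
    mon k 0 0 (n + 3) ∈ reduced κ α β γ := by
  have hj : mon k 2 0 (n + 1) ∈ reduced κ α β γ :=
    mon_mem_reduced_of_two_pos (fun a b c h' => h a b c (by omega)) (by omega)
  have hl : mon k 0 2 (n + 1) ∈ reduced κ α β γ :=
    mon_mem_reduced_of_two_pos (fun a b c h' => h a b c (by omega)) (by omega)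
  have h1 := pderiv_mem_reduced (κ := κ) (α := α) (β := β) (γ := γ) 2 (mon k 0 0 (n + 2))
  have h2 := pderiv_mem_reduced (κ := κ) (α := α) (β := β) (γ := γ) 0 (mon k 1 0 (n + 1))
  refine mem_reduced_of_natCast_mul (n := n + 5) (by omega) ?_
  convert sub_mem (add_mem (add_mem (sub_mem (add_mem (add_mem
    (sub_mem (natCast_mul_mem_reduced (n + 3) h2) (natCast_mul_mem_reduced 2 h1))
    (C_mul_mem_reduced κ (natCast_mul_mem_reduced (n + 1) (h 0 0 (n + 1) (by omega)))))
    (C_mul_mem_reduced γ (natCast_mul_mem_reduced (n + 3) (h 0 0 (n + 2) (by omega)))))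
    (C_mul_mem_reduced α (natCast_mul_mem_reduced 2 (h 1 0 (n + 1) (by omega)))))
    (C_mul_mem_reduced β (natCast_mul_mem_reduced (n + 1) (h 0 1 (n + 1) (by omega)))))
    (natCast_mul_mem_reduced (n + 5) hj)) (natCast_mul_mem_reduced (n + 1) hl) using 1
  simp [cubic, mon, pderiv_X]
  ring

theorem mon_one_mem_reduced : mon k 0 0 0 ∈ reduced κ α β γ ∧ mon k 1 0 0 ∈ reduced κ α β γ ∧
    mon k 0 1 0 ∈ reduced κ α β γ ∧ mon k 0 0 1 ∈ reduced κ α β γ ∧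
    mon k 2 0 0 ∈ reduced κ α β γ := by
  refine ⟨?_, ?_, ?_, ?_, ?_⟩
  · simpa [mon, basisPoly] using basisPoly_mem_reduced (κ := κ) (α := α) (β := β) (γ := γ) 0
  · simpa [mon, basisPoly] using basisPoly_mem_reduced (κ := κ) (α := α) (β := β) (γ := γ) 1
  · simpa [mon, basisPoly] using basisPoly_mem_reduced (κ := κ) (α := α) (β := β) (γ := γ) 2
  · simpa [mon, basisPoly] using basisPoly_mem_reduced (κ := κ) (α := α) (β := β) (γ := γ) 3
  · simpa [mon, basisPoly] using basisPoly_mem_reduced (κ := κ) (α := α) (β := β) (γ := γ) 4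

/-- The products `x₁x₂x₃` cancel in `∂₁(u x₁) - ∂₂(u x₂)` and in `∂₁(u x₁) - ∂₃(u x₃)`, so the three
squares agree up to linear terms. -/
theorem mon_sq_mem_reduced [Algebra ℚ k] :
    mon k 0 2 0 ∈ reduced κ α β γ ∧ mon k 0 0 2 ∈ reduced κ α β γ := by
  obtain ⟨-, hx, hy, hz, hxx⟩ := mon_one_mem_reduced (κ := κ) (α := α) (β := β) (γ := γ)
  have h0 := pderiv_mem_reduced (κ := κ) (α := α) (β := β) (γ := γ) 0 (mon k 1 0 0)
  have h1 := pderiv_mem_reduced (κ := κ) (α := α) (β := β) (γ := γ) 1 (mon k 0 1 0)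
  have h2 := pderiv_mem_reduced (κ := κ) (α := α) (β := β) (γ := γ) 2 (mon k 0 0 1)
  constructor
  · refine mem_reduced_of_natCast_mul (n := 2) two_ne_zero ?_
    convert add_mem (sub_mem (add_mem (sub_mem h0 h1) (natCast_mul_mem_reduced 2 hxx))
      (C_mul_mem_reduced α hx)) (C_mul_mem_reduced β hy) using 1
    simp [cubic, mon, pderiv_X]
    ring
  · refine mem_reduced_of_natCast_mul (n := 2) two_ne_zero ?_
    convert add_mem (sub_mem (add_mem (sub_mem h0 h2) (natCast_mul_mem_reduced 2 hxx))
      (C_mul_mem_reduced α hx)) (C_mul_mem_reduced γ hz) using 1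
    simp [cubic, mon, pderiv_X]
    ring

theorem mon_mem_reduced [Algebra ℚ k] (n : ℕ) :
    ∀ a b c, a + b + c = n → mon k a b c ∈ reduced κ α β γ := by
  induction n using Nat.strong_induction_on with
  | _ n ih =>
  intro a b c hn
  have h : ∀ a' b' c', a' + b' + c' < n → mon k a' b' c' ∈ reduced κ α β γ :=
    fun a' b' c' h' => ih _ h' a' b' c' rfl
  by_cases hpos : 0 < a ∧ 0 < b ∨ 0 < a ∧ 0 < c ∨ 0 < b ∧ 0 < c
  · exact mon_mem_reduced_of_two_pos (fun a' b' c' h' => h a' b' c' (by omega)) hpos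
  obtain ⟨h0, hx, hy, hz, hxx⟩ := mon_one_mem_reduced (κ := κ) (α := α) (β := β) (γ := γ)
  obtain ⟨hyy, hzz⟩ := mon_sq_mem_reduced (κ := κ) (α := α) (β := β) (γ := γ)
  have hcases : (b = 0 ∧ c = 0) ∨ (a = 0 ∧ c = 0) ∨ (a = 0 ∧ b = 0) := by omega
  rcases hcases with ⟨rfl, rfl⟩ | ⟨rfl, rfl⟩ | ⟨rfl, rfl⟩
  · rcases a with _ | _ | _ | a
    · exact h0
    · exact hx
    · exact hxx
    · exact mon_mem_reduced_x fun a' b' c' h' => h a' b' c' (by omega)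
  · rcases b with _ | _ | _ | b
    · exact h0
    · exact hy
    · exact hyy
    · exact mon_mem_reduced_y fun a' b' c' h' => h a' b' c' (by omega)
  · rcases c with _ | _ | _ | c
    · exact h0
    · exact hz
    · exact hzz
    · exact mon_mem_reduced_z fun a' b' c' h' => h a' b' c' (by omega)

/-- Modulo divergences of multiples of the cubic, every polynomial is a combination of
`1, x₁, x₂, x₃, x₁²`. -/
theorem exists_basisPoly_add_divMul [Algebra ℚ k] (κ α β γ : k) (p : MvPolynomial (Fin 3) k) :
    ∃ (a : Fin 5 → k) (h : Fin 3 → MvPolynomial (Fin 3) k),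
      p = ∑ j, a j • basisPoly k j + divMul (cubic κ α β γ) h := by
  have hp : p ∈ reduced κ α β γ := by
    induction p using MvPolynomial.induction_on' with
    | monomial s a =>
      have := C_mul_mem_reduced a (mon_mem_reduced (κ := κ) (α := α) (β := β) (γ := γ) _
        (s 0) (s 1) (s 2) rfl)
      rw [monomial_eq, Finsupp.prod_fintype _ _ (by simp), Fin.prod_univ_three]
      exact this
    | add p q hp hq => exact add_mem hp hq
  obtain ⟨w, ⟨h, rfl⟩, y, hy, rfl⟩ := Submodule.mem_sup.1 hp
  obtain ⟨a, rfl⟩ := (Submodule.mem_span_range_iff_exists_fun k).1 hy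
  exact ⟨a, h, add_comm _ _⟩

end Span

end Cubic

/-! # Algebraic forms on `ℂ³` in coordinates -/

/-- The constant coordinate vector field `∂/∂xᵢ`. -/
noncomputable abbrev coordVec (i : Fin 3) : Fin 3 → ℂ := Pi.single i 1

theorem dirDeriv_coordVec (i : Fin 3) (f : MvPolynomial (Fin 3) ℂ) :
    dirDeriv 3 (coordVec i) f = pderiv i f := by
  rw [dirDeriv_apply, Finset.sum_eq_single i]
  · simp
  · intro j _ hj
    simp [hj]
  · simp

/-- The coefficient of `dx₁ ∧ dx₂ ∧ dx₃` in a `3`-form. -/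
noncomputable def volCoeff : PolyForm 3 3 →ₗ[ℂ] MvPolynomial (Fin 3) ℂ where
  toFun ω := ω coordVec
  map_add' _ _ := rfl
  map_smul' _ _ := rfl

theorem volCoeff_smul (f : MvPolynomial (Fin 3) ℂ) (ω : PolyForm 3 3) :
    volCoeff (f • ω) = f * volCoeff ω := rfl

theorem volCoeff_injective : Function.Injective volCoeff := by
  intro ω η h
  refine Module.Basis.ext_alternating (Pi.basisFun ℂ (Fin 3)) fun v hv => ?_
  let σ : Equiv.Perm (Fin 3) := Equiv.ofBijective v (Finite.injective_iff_bijective.1 hv)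
  have hσ : (fun i => Pi.basisFun ℂ (Fin 3) (v i)) = (coordVec : Fin 3 → Fin 3 → ℂ) ∘ σ := by
    funext i
    simp [σ, coordVec]
  have h' : ω coordVec = η coordVec := h
  rw [hσ, AlternatingMap.map_perm, AlternatingMap.map_perm, h']

theorem polyForm_two_ext {ω η : PolyForm 3 2}
    (h12 : ω ![coordVec 1, coordVec 2] = η ![coordVec 1, coordVec 2])
    (h02 : ω ![coordVec 0, coordVec 2] = η ![coordVec 0, coordVec 2])
    (h01 : ω ![coordVec 0, coordVec 1] = η ![coordVec 0, coordVec 1]) : ω = η := by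
  refine Module.Basis.ext_alternating (Pi.basisFun ℂ (Fin 3)) fun v hv => ?_
  have hv' : (fun i => Pi.basisFun ℂ (Fin 3) (v i)) = ![coordVec (v 0), coordVec (v 1)] := by
    funext i
    fin_cases i <;> simp [coordVec]
  have hswap : ∀ (θ : PolyForm 3 2) (i j : Fin 3),
      θ ![coordVec j, coordVec i] = -θ ![coordVec i, coordVec j] := by
    intro θ i j
    rw [← θ.map_swap _ (show (0 : Fin 2) ≠ 1 by decide)]
    congr 1
    funext l
    fin_cases l <;> simp
  have hne : v 0 ≠ v 1 := fun h => absurd (hv h) (by decide)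
  rw [hv']
  generalize v 0 = i at hne ⊢
  generalize v 1 = j at hne ⊢
  fin_cases i <;> fin_cases j <;> simp only [Fin.zero_eta, Fin.mk_one, Fin.reduceFinMk] at hne ⊢
  · exact absurd rfl hne
  · exact h01
  · exact h02
  · rw [hswap, h01, ← hswap]
  · exact absurd rfl hne
  · exact h12
  · rw [hswap, h02, ← hswap]
  · rw [hswap, h12, ← hswap]
  · exact absurd rfl hne

theorem removeNth_coordVec (r : Fin 3) : r.removeNth coordVec =
    ![![coordVec 1, coordVec 2], ![coordVec 0, coordVec 2], ![coordVec 0, coordVec 1]] r := by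
  funext i
  fin_cases r <;> fin_cases i <;> rfl

theorem volCoeff_polyExtDeriv (ω : PolyForm 3 2) :
    volCoeff (polyExtDeriv 3 2 ω) = pderiv 0 (ω ![coordVec 1, coordVec 2]) -
      pderiv 1 (ω ![coordVec 0, coordVec 2]) + pderiv 2 (ω ![coordVec 0, coordVec 1]) := by
  change polyExtDeriv 3 2 ω coordVec = _
  rw [polyExtDeriv_apply]
  refine (Fin.sum_univ_three _).trans ?_
  simp [removeNth_coordVec, dirDeriv_coordVec, sub_eq_add_neg]

theorem volCoeff_dWedge (f : MvPolynomial (Fin 3) ℂ) (ω : PolyForm 3 2) :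
    volCoeff (dWedge f ω) = pderiv 0 f * ω ![coordVec 1, coordVec 2] -
      pderiv 1 f * ω ![coordVec 0, coordVec 2] + pderiv 2 f * ω ![coordVec 0, coordVec 1] := by
  change dWedge f ω coordVec = _
  rw [dWedge_apply]
  refine (Fin.sum_univ_three _).trans ?_
  simp [removeNth_coordVec, dirDeriv_coordVec, sub_eq_add_neg]

/-- The `2`-form `h₁ dx₂∧dx₃ - h₂ dx₁∧dx₃ + h₃ dx₁∧dx₂`. -/
noncomputable def twoForm (h : Fin 3 → MvPolynomial (Fin 3) ℂ) : PolyForm 3 2 :=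
  h 0 • dxForm ![1, 2] - h 1 • dxForm ![0, 2] + h 2 • dxForm ![0, 1]

theorem twoForm_apply (h : Fin 3 → MvPolynomial (Fin 3) ℂ) :
    twoForm h ![coordVec 1, coordVec 2] = h 0 ∧ twoForm h ![coordVec 0, coordVec 2] = -h 1 ∧
      twoForm h ![coordVec 0, coordVec 1] = h 2 := by
  refine ⟨?_, ?_, ?_⟩ <;>
    simp [twoForm, dxForm_apply, Matrix.det_fin_two]

/-- The `1`-form `a₁ dx₁ + a₂ dx₂ + a₃ dx₃`. -/
noncomputable def oneForm (a : Fin 3 → MvPolynomial (Fin 3) ℂ) : PolyForm 3 1 :=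
  ∑ i, a i • dxForm ![i]

theorem oneForm_apply (a : Fin 3 → MvPolynomial (Fin 3) ℂ) (i : Fin 3) :
    oneForm a ![coordVec i] = a i := by
  fin_cases i <;> simp [oneForm, dxForm_apply, Fin.sum_univ_three]

theorem polyExtDeriv_oneForm (a : Fin 3 → MvPolynomial (Fin 3) ℂ) (i j : Fin 3) :
    polyExtDeriv 3 1 (oneForm a) ![coordVec i, coordVec j] =
      pderiv i (a j) - pderiv j (a i) := by
  have h0 : (0 : Fin 2).removeNth ![coordVec i, coordVec j] = ![coordVec j] := by
    funext l; fin_cases l; rfl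
  have h1 : (1 : Fin 2).removeNth ![coordVec i, coordVec j] = ![coordVec i] := by
    funext l; fin_cases l; rfl
  rw [polyExtDeriv_apply, Fin.sum_univ_two, h0, h1, oneForm_apply, oneForm_apply]
  simp only [Matrix.cons_val_zero, Matrix.cons_val_one, dirDeriv_coordVec]
  simp [sub_eq_add_neg]

/-! ### The Poincaré lemma for polynomial 2-forms -/

/-- Antidifferentiation in the `i`-th variable. -/
noncomputable def antideriv (i : Fin 3) : MvPolynomial (Fin 3) ℂ →ₗ[ℂ] MvPolynomial (Fin 3) ℂ :=
  (basisMonomials (Fin 3) ℂ).constr ℂ fun s =>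
    monomial (s + Finsupp.single i 1) ((s i + 1 : ℂ)⁻¹)

theorem antideriv_monomial (i : Fin 3) (s : Fin 3 →₀ ℕ) :
    antideriv i (monomial s 1) = monomial (s + Finsupp.single i 1) ((s i + 1 : ℂ)⁻¹) := by
  have := (basisMonomials (Fin 3) ℂ).constr_basis ℂ (fun s : Fin 3 →₀ ℕ =>
    monomial (s + Finsupp.single i 1) ((s i + 1 : ℂ)⁻¹)) s
  rwa [coe_basisMonomials] at this

theorem pderiv_antideriv (i : Fin 3) (p : MvPolynomial (Fin 3) ℂ) :
    pderiv i (antideriv i p) = p := by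
  have : ((pderiv i : Derivation ℂ (MvPolynomial (Fin 3) ℂ) (MvPolynomial (Fin 3) ℂ)) :
      MvPolynomial (Fin 3) ℂ →ₗ[ℂ] MvPolynomial (Fin 3) ℂ) ∘ₗ antideriv i = LinearMap.id := by
    refine (basisMonomials (Fin 3) ℂ).ext fun s => ?_
    have hs : (s i + 1 : ℂ) ≠ 0 := Nat.cast_add_one_ne_zero _
    simp [antideriv_monomial, pderiv_monomial, hs]
  exact LinearMap.congr_fun this p

theorem pderiv_antideriv_comm {i j : Fin 3} (hij : i ≠ j) (p : MvPolynomial (Fin 3) ℂ) :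
    pderiv j (antideriv i p) = antideriv i (pderiv j p) := by
  have : ((pderiv j : Derivation ℂ (MvPolynomial (Fin 3) ℂ) (MvPolynomial (Fin 3) ℂ)) :
      MvPolynomial (Fin 3) ℂ →ₗ[ℂ] MvPolynomial (Fin 3) ℂ) ∘ₗ antideriv i =
      antideriv i ∘ₗ ((pderiv j : Derivation ℂ (MvPolynomial (Fin 3) ℂ)
        (MvPolynomial (Fin 3) ℂ)) : MvPolynomial (Fin 3) ℂ →ₗ[ℂ] MvPolynomial (Fin 3) ℂ) := by
    refine (basisMonomials (Fin 3) ℂ).ext fun s => ?_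
    have h1 : ∀ c : ℂ, monomial (s - Finsupp.single j 1) c =
        c • monomial (s - Finsupp.single j 1) 1 := fun c => by simp [smul_monomial]
    simp only [coe_basisMonomials, LinearMap.comp_apply, antideriv_monomial, Derivation.coeFn_coe,
      pderiv_monomial]
    rw [h1 (1 * _), map_smul, antideriv_monomial, smul_monomial]
    by_cases hs : s j = 0
    · simp [hs, hij]
    · have h2 : s + Finsupp.single i 1 - Finsupp.single j 1 =
          s - Finsupp.single j 1 + Finsupp.single i 1 := by
        ext l
        have : (Finsupp.single j 1 : Fin 3 →₀ ℕ) l ≤ s l := by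
          by_cases hl : l = j
          · subst hl; simp; omega
          · simp [Ne.symm hl]
        simp only [Finsupp.coe_tsub, Finsupp.coe_add, Pi.sub_apply, Pi.add_apply]
        omega
      rw [h2]
      simp [hij, hij.symm, mul_comm]
  exact LinearMap.congr_fun this p

/-- The Poincaré lemma for `2`-forms on `ℂ³`. -/
theorem exists_polyExtDeriv_eq_of_closed {ω : PolyForm 3 2}
    (h : volCoeff (polyExtDeriv 3 2 ω) = 0) : ∃ θ : PolyForm 3 1, polyExtDeriv 3 1 θ = ω := by
  rw [volCoeff_polyExtDeriv] at h
  set p := ω ![coordVec 1, coordVec 2] with hp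
  set q := ω ![coordVec 0, coordVec 2] with hq
  set s := ω ![coordVec 0, coordVec 1] with hs
  -- Antiderivatives in `x₃` remove the coefficients of `dx₁∧dx₃` and `dx₂∧dx₃`, leaving `r
  -- dx₁∧dx₂`. Closedness makes `r` independent of `x₃`, so an antiderivative in `x₁` finishes.
  let r := s + pderiv 0 (antideriv 2 p) - pderiv 1 (antideriv 2 q)
  have hr : pderiv 2 r = 0 := by
    simp only [r, map_add, map_sub, ← dirDeriv_coordVec]
    rw [dirDeriv_comm (coordVec 2) (coordVec 0), dirDeriv_comm (coordVec 2) (coordVec 1)]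
    simp only [dirDeriv_coordVec, pderiv_antideriv]
    rw [← h]
    ring
  refine ⟨oneForm ![-antideriv 2 q, antideriv 0 r - antideriv 2 p, 0], polyForm_two_ext ?_ ?_ ?_⟩
  · rw [polyExtDeriv_oneForm]
    simp [pderiv_antideriv, pderiv_antideriv_comm (show (0 : Fin 3) ≠ 2 by decide), hr, ← hp]
  · rw [polyExtDeriv_oneForm]
    simp [pderiv_antideriv, ← hq]
  · rw [polyExtDeriv_oneForm]
    simp only [Matrix.cons_val_zero, Matrix.cons_val_one, map_sub, map_neg, pderiv_antideriv, r]
    ring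

/-! # The second de Rham cohomology of a smooth surface in `ℂ³` -/

variable {u : MvPolynomial (Fin 3) ℂ}

theorem volCoeff_polyExtDeriv_smul_twoForm (h : Fin 3 → MvPolynomial (Fin 3) ℂ) :
    volCoeff (polyExtDeriv 3 2 (u • twoForm h)) = divMul u h := by
  obtain ⟨h0, h1, h2⟩ := twoForm_apply h
  rw [volCoeff_polyExtDeriv, divMul_apply, Fin.sum_univ_three]
  simp only [AlternatingMap.smul_apply, h0, h1, h2, smul_eq_mul, mul_neg, map_neg]
  ring

theorem volCoeff_polyExtDeriv_smul_mem (ω : PolyForm 3 2) :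
    volCoeff (polyExtDeriv 3 2 (u • ω)) ∈ divSubmodule u := by
  rw [volCoeff_polyExtDeriv]
  exact add_mem (sub_mem (pderiv_mul_mem_divSubmodule _ _ _) (pderiv_mul_mem_divSubmodule _ _ _))
    (pderiv_mul_mem_divSubmodule _ _ _)

/-- For `f = g u`, `d(df ∧ η) = -df ∧ dη = -d(u · g dη)`, so both kinds of generators have
differential `d(u ·)`. -/
theorem volCoeff_polyExtDeriv_mem_of_vanishing {ω : PolyForm 3 2}
    (hω : ω ∈ vanishingForms (Ideal.span {u}) 2) :
    volCoeff (polyExtDeriv 3 2 ω) ∈ divSubmodule u := by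
  -- The vanishing forms are an `𝒪`-span while `d` is only `ℂ`-linear, so the induction carries an
  -- arbitrary multiplier `a`.
  have key : ∀ ω ∈ vanishingForms (Ideal.span {u}) 2, ∀ a : MvPolynomial (Fin 3) ℂ,
      volCoeff (polyExtDeriv 3 2 (a • ω)) ∈ divSubmodule u := by
    intro ω hω
    rw [vanishingForms, ← Submodule.span_union] at hω
    induction hω using Submodule.span_induction with
    | mem θ hθ =>
      intro a
      rcases hθ with ⟨f, hf, η, rfl⟩ | ⟨f, hf, η, rfl⟩
      · obtain ⟨g, rfl⟩ := Ideal.mem_span_singleton'.1 hf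
        rw [smul_smul, mul_comm g u, mul_left_comm, mul_smul]
        exact volCoeff_polyExtDeriv_smul_mem _
      · obtain ⟨g, rfl⟩ := Ideal.mem_span_singleton'.1 hf
        rw [smul_dWedge, polyExtDeriv_dWedge, dWedge_eq, polyExtDeriv_polyExtDeriv, smul_zero,
          sub_zero, map_neg, mul_comm g u, mul_smul]
        exact neg_mem (volCoeff_polyExtDeriv_smul_mem _)
    | zero => intro a; simp
    | add x y _ _ hx hy => intro a; rw [smul_add, map_add, map_add]; exact add_mem (hx a) (hy a)
    | smul c x _ hx => intro a; rw [smul_smul]; exact hx _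
  simpa using key ω hω 1

/-- If `u` and its partial derivatives generate the unit ideal, then every `3`-form vanishes on the
surface `u = 0`. -/
theorem vanishingForms_three_eq_top {r : MvPolynomial (Fin 3) ℂ}
    {a : Fin 3 → MvPolynomial (Fin 3) ℂ} (h : r * u + ∑ i, a i * pderiv i u = 1) :
    vanishingForms (Ideal.span {u}) 3 = ⊤ := by
  refine (Submodule.eq_top_iff').2 fun ω => ?_
  have hu : u ∈ Ideal.span {u} := Ideal.mem_span_singleton_self u
  -- If `ι_a vol` denotes the contraction of the volume form with the field `a`, then `du ∧ ι_a vol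
  -- = (∑ aᵢ ∂ᵢu) vol`; the unit relation is multiplied by `ω`.
  have hω : ω = (r * u) • ω + dWedge u (twoForm fun i => volCoeff ω * a i) := by
    apply volCoeff_injective
    obtain ⟨h0, h1, h2⟩ := twoForm_apply fun i => volCoeff ω * a i
    rw [map_add, volCoeff_smul, volCoeff_dWedge, h0, h1, h2]
    rw [Fin.sum_univ_three] at h
    linear_combination (-volCoeff ω) * h
  rw [hω]
  exact add_mem (smul_mem_vanishingForms (Ideal.mul_mem_left _ r hu) _)
    (dWedge_mem_vanishingForms hu _)

theorem closedForms_two_eq_top {r : MvPolynomial (Fin 3) ℂ}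
    {a : Fin 3 → MvPolynomial (Fin 3) ℂ} (h : r * u + ∑ i, a i * pderiv i u = 1) :
    closedForms (Ideal.span {u}) 2 = ⊤ := by
  refine (Submodule.eq_top_iff').2 fun ω => LinearMap.mem_ker.2 ?_
  have : Subsingleton (DeRhamForm (Ideal.span {u}) (2 + 1)) :=
    Submodule.Quotient.subsingleton_iff.2 <| (Submodule.eq_top_iff').2 fun θ => by
      have := vanishingForms_three_eq_top h
      exact (this ▸ Submodule.mem_top : θ ∈ vanishingForms (Ideal.span {u}) 3)
  exact Subsingleton.elim _ _

/-- A `2`-form is exact on the surface `u = 0` if and only if the coefficient of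
its exterior derivative on `ℂ³` is the divergence of a vector field divisible by `u`. -/
theorem restrictForm_mem_exactForms_iff (ω : PolyForm 3 2) :
    restrictForm (Ideal.span {u}) 2 ω ∈ exactForms (Ideal.span {u}) 2 ↔
      volCoeff (polyExtDeriv 3 2 ω) ∈ divSubmodule u := by
  constructor
  · rintro ⟨θ, hθ⟩
    obtain ⟨θ, rfl⟩ := Submodule.mkQ_surjective _ θ
    have hθ' : restrictForm (Ideal.span {u}) 2 (polyExtDeriv 3 1 θ) =
      restrictForm (Ideal.span {u}) 2 ω := hθ
    have h2 : ω - polyExtDeriv 3 1 θ ∈ vanishingForms (Ideal.span {u}) 2 :=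
      (Submodule.Quotient.eq _).1 hθ'.symm
    have h3 := volCoeff_polyExtDeriv_mem_of_vanishing h2
    rwa [map_sub, polyExtDeriv_polyExtDeriv, sub_zero] at h3
  · rintro ⟨h, hh⟩
    rw [← volCoeff_polyExtDeriv_smul_twoForm] at hh
    -- `ω - uη` is closed on `ℂ³`, hence exact there, and `uη` vanishes on the surface.
    obtain ⟨θ, hθ⟩ := exists_polyExtDeriv_eq_of_closed (ω := ω - u • twoForm h)
      (by rw [map_sub, map_sub, hh, sub_self])
    refine ⟨restrictForm _ 1 θ, ?_⟩
    change restrictForm (Ideal.span {u}) 2 (polyExtDeriv 3 1 θ) = _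
    rw [hθ]
    refine (Submodule.Quotient.eq _).2 ?_
    rw [sub_sub_cancel_left]
    exact neg_mem (smul_mem_vanishingForms (Ideal.mem_span_singleton_self u) _)

/-- If `u` and its partial derivatives generate the unit ideal, then `2`-forms `ω j` represent a
basis of the second cohomology of the surface `u = 0` as soon as the coefficients of the `dω j` are a
basis modulo divergences of vector fields divisible by `u`. -/
theorem exists_deRham_basis {ι : Type} [Fintype ι] {r : MvPolynomial (Fin 3) ℂ}
    {a : Fin 3 → MvPolynomial (Fin 3) ℂ} (h : r * u + ∑ i, a i * pderiv i u = 1)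
    (ω : ι → PolyForm 3 2)
    (hli : ∀ c : ι → ℂ, ∑ j, c j • volCoeff (polyExtDeriv 3 2 (ω j)) ∈ divSubmodule u → c = 0)
    (hspan : ∀ p, ∃ c : ι → ℂ,
      p - ∑ j, c j • volCoeff (polyExtDeriv 3 2 (ω j)) ∈ divSubmodule u) :
    ∃ B : Module.Basis ι ℂ (DeRhamCohomology (Ideal.span {u}) 2),
      ∀ j, ∃ hj : restrictForm (Ideal.span {u}) 2 (ω j) ∈ closedForms (Ideal.span {u}) 2,
        B j = deRhamClass (Ideal.span {u}) 2 ⟨restrictForm (Ideal.span {u}) 2 (ω j), hj⟩ := by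
  have hcl : ∀ θ, θ ∈ closedForms (Ideal.span {u}) 2 := fun θ => by
    rw [closedForms_two_eq_top h]; trivial
  let cls : PolyForm 3 2 →ₗ[ℂ] DeRhamCohomology (Ideal.span {u}) 2 :=
    deRhamClass (Ideal.span {u}) 2 ∘ₗ
      (restrictForm (Ideal.span {u}) 2).codRestrict _ fun θ => hcl _
  have hcls : ∀ θ, cls θ = 0 ↔ volCoeff (polyExtDeriv 3 2 θ) ∈ divSubmodule u := fun θ => by
    rw [← restrictForm_mem_exactForms_iff]
    exact Submodule.Quotient.mk_eq_zero _
  have hsurj : Function.Surjective cls := by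
    intro x
    obtain ⟨⟨y, hy⟩, rfl⟩ := Submodule.mkQ_surjective _ x
    obtain ⟨θ, rfl⟩ := Submodule.mkQ_surjective _ y
    exact ⟨θ, rfl⟩
  have hsum : ∀ c : ι → ℂ, volCoeff (polyExtDeriv 3 2 (∑ j, c j • ω j)) =
      ∑ j, c j • volCoeff (polyExtDeriv 3 2 (ω j)) := fun c => by
    simp only [map_sum, map_smul]
  have hli' : LinearIndependent ℂ fun j => cls (ω j) := by
    rw [Fintype.linearIndependent_iff]
    intro c hc
    simp only [← map_smul, ← map_sum] at hc
    rw [hcls, hsum] at hc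
    exact fun j => congrFun (hli c hc) j
  have hsp : ⊤ ≤ Submodule.span ℂ (Set.range fun j => cls (ω j)) := by
    rintro x -
    obtain ⟨θ, rfl⟩ := hsurj x
    obtain ⟨c, hc⟩ := hspan (volCoeff (polyExtDeriv 3 2 θ))
    rw [← hsum, ← map_sub, ← map_sub, ← hcls, map_sub, sub_eq_zero] at hc
    rw [hc, map_sum]
    refine Submodule.sum_mem _ fun j _ => ?_
    rw [map_smul]
    exact Submodule.smul_mem _ _ (Submodule.subset_span ⟨j, rfl⟩)
  refine ⟨Module.Basis.mk hli' hsp, fun j => ⟨hcl _, ?_⟩⟩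
  rw [Module.Basis.mk_apply]
  rfl

/-! # The Jacobian criterion for hypersurfaces -/

section Jacobian

variable {k σ : Type*} [CommRing k]

/-- The algebra homomorphism `f ↦ f - u D f` to the quotient by an ideal containing `u²`. -/
noncomputable def thickeningHom (u : MvPolynomial σ k) {J : Ideal (MvPolynomial σ k)}
    (hJ : u ^ 2 ∈ J) (D : Derivation k (MvPolynomial σ k) (MvPolynomial σ k)) :
    MvPolynomial σ k →ₐ[k] MvPolynomial σ k ⧸ J :=
  AlgHom.ofLinearMap ((Ideal.Quotient.mkₐ k J).toLinearMap ∘ₗ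
      (LinearMap.id - LinearMap.mulLeft k u ∘ₗ (D : MvPolynomial σ k →ₗ[k] MvPolynomial σ k)))
    (by simp)
    (by
      intro f g
      simp only [LinearMap.comp_apply, AlgHom.toLinearMap_apply, Ideal.Quotient.mkₐ_eq_mk,
        LinearMap.sub_apply, LinearMap.id_apply, LinearMap.mulLeft_apply, Derivation.coeFn_coe]
      rw [← map_mul]
      refine Ideal.Quotient.eq.2 ?_
      -- The failure of `f ↦ f - u D f` to be multiplicative is `u² Df Dg`.
      convert J.mul_mem_left (-(D f * D g)) hJ using 1
      rw [D.leibniz, smul_eq_mul, smul_eq_mul]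
      ring)

theorem thickeningHom_apply (u : MvPolynomial σ k) {J : Ideal (MvPolynomial σ k)}
    (hJ : u ^ 2 ∈ J) (D : Derivation k (MvPolynomial σ k) (MvPolynomial σ k))
    (f : MvPolynomial σ k) : thickeningHom u hJ D f = Ideal.Quotient.mk J (f - u * D f) := rfl

theorem mkDerivation_apply_eq_sum [Fintype σ] (a : σ → MvPolynomial σ k) (f : MvPolynomial σ k) :
    mkDerivation k a f = ∑ i, a i * pderiv i f := by
  classical
  let D : σ → Derivation k (MvPolynomial σ k) (MvPolynomial σ k) := fun i => a i • pderiv i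
  have hD : ∀ g, (∑ i, D i) g = ∑ i, a i * pderiv i g := fun g => by
    have := congrFun (map_sum (Derivation.coeFnAddMonoidHom (R := k) (A := MvPolynomial σ k)
      (M := MvPolynomial σ k)) D Finset.univ) g
    rw [Finset.sum_apply, Derivation.coeFnAddMonoidHom_apply] at this
    exact this
  have : mkDerivation k a = ∑ i, D i := by
    refine derivation_ext fun i => ?_
    rw [mkDerivation_X, hD, Finset.sum_eq_single i]
    · simp
    · intro j _ hj
      simp [pderiv_X_of_ne hj.symm]
    · simp
  rw [this, hD]

/-- The Jacobian criterion for a hypersurface. -/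
theorem formallySmooth_quotient_span_iff [IsDomain k] [Fintype σ] {u : MvPolynomial σ k}
    (hu : u ≠ 0) : Algebra.FormallySmooth k (MvPolynomial σ k ⧸ Ideal.span {u}) ↔
      ∃ (r : MvPolynomial σ k) (a : σ → MvPolynomial σ k), r * u + ∑ i, a i * pderiv i u = 1 := by
  let f := Ideal.Quotient.mkₐ k (Ideal.span {u})
  have hf : Function.Surjective f := Ideal.Quotient.mkₐ_surjective k _
  have hker : RingHom.ker f.toRingHom = Ideal.span {u} := Ideal.Quotient.mkₐ_ker k _
  have hker2 : RingHom.ker f.toRingHom ^ 2 = Ideal.span {u ^ 2} := by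
    rw [hker, Ideal.span_singleton_pow]
  have hJ : u ^ 2 ∈ RingHom.ker f.toRingHom ^ 2 := by
    rw [hker2]; exact Ideal.mem_span_singleton_self _
  -- Formal smoothness means that the quotient map modulo `u²` onto the quotient modulo `u` has an
  -- algebra section.
  rw [Algebra.FormallySmooth.iff_split_surjection f hf]
  constructor
  · rintro ⟨g, hg⟩
    have hx : ∀ i, ∃ r, g (f (X i)) = Ideal.Quotient.mk _ (X i - u * r) := by
      intro i
      obtain ⟨q, hq⟩ := Ideal.Quotient.mk_surjective (g (f (X i)))
      have h1 : f q = f (X i) := by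
        have := AlgHom.congr_fun hg (f (X i))
        rw [AlgHom.comp_apply, ← hq] at this
        exact this
      have h2 : X i - q ∈ Ideal.span {u} := Ideal.Quotient.eq.1 h1.symm
      obtain ⟨r, hr⟩ := Ideal.mem_span_singleton'.1 h2
      exact ⟨r, by rw [← hq, mul_comm, hr, sub_sub_cancel]⟩
    choose a ha using hx
    -- A section moves each variable by a multiple of `u`, so it is `p ↦ p - u D p`. It sends `u` to
    -- `0`, i.e. `u - u D u ∈ (u²)`, and cancelling `u` gives the unit relation.
    have h1 : g.comp f = thickeningHom u hJ (mkDerivation k a) := by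
      refine algHom_ext fun i => ?_
      rw [thickeningHom_apply, mkDerivation_X, ← ha, AlgHom.comp_apply]
    have h2 := AlgHom.congr_fun h1 u
    have h3 : f u = 0 := Ideal.Quotient.eq_zero_iff_mem.2 (Ideal.mem_span_singleton_self u)
    rw [AlgHom.comp_apply, h3, map_zero, thickeningHom_apply, eq_comm,
      Ideal.Quotient.eq_zero_iff_mem, hker2, mkDerivation_apply_eq_sum] at h2
    obtain ⟨r, hr⟩ := Ideal.mem_span_singleton'.1 h2
    refine ⟨r, a, mul_left_cancel₀ hu ?_⟩
    linear_combination hr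
  · rintro ⟨r, a, h⟩
    let φ := thickeningHom u hJ (mkDerivation k a)
    have hφ : ∀ p ∈ Ideal.span {u}, φ p = 0 := by
      intro p hp
      obtain ⟨q, rfl⟩ := Ideal.mem_span_singleton'.1 hp
      rw [thickeningHom_apply, Ideal.Quotient.eq_zero_iff_mem, hker2]
      refine Ideal.mem_span_singleton'.2 ⟨q * r - mkDerivation k a q, ?_⟩
      rw [Derivation.leibniz, mkDerivation_apply_eq_sum a u, smul_eq_mul, smul_eq_mul]
      linear_combination (q * u) * h
    refine ⟨Ideal.Quotient.liftₐ _ φ hφ, ?_⟩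
    refine AlgHom.ext fun x => ?_
    obtain ⟨p, rfl⟩ := Ideal.Quotient.mk_surjective x
    change f (p - u * mkDerivation k a p) = f p
    have h3 : f u = 0 := Ideal.Quotient.eq_zero_iff_mem.2 (Ideal.mem_span_singleton_self u)
    rw [map_sub, map_mul, h3, zero_mul, sub_zero]

/-- A polynomial and its partial derivatives generate the unit ideal if and only if they have no
common zero. -/
theorem exists_combination_eq_one_iff {k : Type*} [Field k] [IsAlgClosed k] {σ : Type*} [Fintype σ]
    (u : MvPolynomial σ k) :
    (∃ (r : MvPolynomial σ k) (a : σ → MvPolynomial σ k), r * u + ∑ i, a i * pderiv i u = 1) ↔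
      ¬ ∃ x : σ → k, eval x u = 0 ∧ ∀ i, eval x (pderiv i u) = 0 := by
  constructor
  · rintro ⟨r, a, h⟩ ⟨x, hx, hx'⟩
    have := congrArg (eval x) h
    simp [hx, hx'] at this
  · intro h
    let I := Ideal.span {u} ⊔ Ideal.span (Set.range fun i => pderiv i u)
    have hI : I = ⊤ := by
      rw [← Ideal.radical_eq_top, ← vanishingIdeal_zeroLocus_eq_radical (K := k) I]
      have : zeroLocus k I = ∅ := by
        refine Set.eq_empty_of_forall_notMem fun x hx => h ⟨x, ?_, fun i => ?_⟩
        · exact hx u (Ideal.mem_sup_left (Ideal.mem_span_singleton_self u))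
        · exact hx _ (Ideal.mem_sup_right (Ideal.subset_span ⟨i, rfl⟩))
      rw [this, vanishingIdeal_empty]
    have h1 : (1 : MvPolynomial σ k) ∈ I := hI ▸ Submodule.mem_top
    obtain ⟨y, hy, z, hz, hyz⟩ := Submodule.mem_sup.1 h1
    obtain ⟨r, rfl⟩ := Ideal.mem_span_singleton'.1 hy
    obtain ⟨a, rfl⟩ := (Submodule.mem_span_range_iff_exists_fun _).1 hz
    exact ⟨r, a, hyz⟩

/-- An affine hypersurface over an algebraically closed field is smooth if and only if it has no
singular point. -/
theorem smooth_quotient_span_iff {k : Type*} [Field k] [IsAlgClosed k] {σ : Type*} [Fintype σ]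
    {u : MvPolynomial σ k} (hu : u ≠ 0) :
    Algebra.Smooth k (MvPolynomial σ k ⧸ Ideal.span {u}) ↔
      ¬ ∃ x : σ → k, eval x u = 0 ∧ ∀ i, eval x (pderiv i u) = 0 := by
  rw [← exists_combination_eq_one_iff, ← formallySmooth_quotient_span_iff hu]
  refine ⟨fun h => h.formallySmooth, fun h => ⟨h, ?_⟩⟩
  exact Algebra.FinitePresentation.quotient (Submodule.fg_span_singleton u)

end Jacobian

/-! # Singular points of the four-holed sphere cubics -/

theorem fourHoledPoly_eq_cubic (b : Fin 4 → ℂ) : fourHoledPoly b =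
    cubic (4 - b 0 ^ 2 - b 1 ^ 2 - b 2 ^ 2 - b 0 * b 1 * b 2 * b 3 - b 3 ^ 2)
      (b 0 * b 1 + b 2 * b 3) (b 0 * b 2 + b 1 * b 3) (b 1 * b 2 + b 0 * b 3) := by
  rw [fourHoledPoly, cubic]
  ring

/-- The alternating sum of values over the vertices of `{0, 1}³` isolates the coefficient of
`x₁x₂x₃`. -/
theorem cubic_ne_zero {k : Type*} [Field k] [CharZero k] (κ α β γ : k) : cubic κ α β γ ≠ 0 := by
  intro h
  have h1 := congrArg (eval ![1, 1, 1]) h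
  have h2 := congrArg (eval ![1, 1, 0]) h
  have h3 := congrArg (eval ![1, 0, 1]) h
  have h4 := congrArg (eval ![1, 0, 0]) h
  have h5 := congrArg (eval ![0, 0, 1]) h
  have h6 := congrArg (eval ![0, 0, 0]) h
  have h7 := congrArg (eval ![0, 1, 1]) h
  have h8 := congrArg (eval ![0, 1, 0]) h
  simp [cubic] at h1 h2 h3 h4 h5 h6 h7 h8
  have : (1 : k) = 0 := by
    linear_combination h2 + h3 - h4 - h1 + h7 + h6 - h5 - h8
  exact one_ne_zero this

/-- The singular points of the cubic surface. -/
def IsCubicSingular (κ α β γ x y z : ℂ) : Prop :=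
  κ + α * x + β * y + γ * z - x ^ 2 - y ^ 2 - z ^ 2 - x * y * z = 0 ∧
    α - 2 * x - y * z = 0 ∧ β - 2 * y - x * z = 0 ∧ γ - 2 * z - x * y = 0

theorem exists_singular_cubic_iff (κ α β γ : ℂ) :
    (∃ x : Fin 3 → ℂ, eval x (cubic κ α β γ) = 0 ∧ ∀ i, eval x (pderiv i (cubic κ α β γ)) = 0) ↔
      ∃ x y z, IsCubicSingular κ α β γ x y z := by
  have key : ∀ x : Fin 3 → ℂ, (eval x (cubic κ α β γ) = 0 ∧
      ∀ i, eval x (pderiv i (cubic κ α β γ)) = 0) ↔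
      IsCubicSingular κ α β γ (x 0) (x 1) (x 2) := by
    intro x
    have h : eval x (cubic κ α β γ) = κ + α * x 0 + β * x 1 + γ * x 2 - x 0 ^ 2 - x 1 ^ 2 -
        x 2 ^ 2 - x 0 * x 1 * x 2 := by
      simp [cubic]
    have h0 : eval x (pderiv 0 (cubic κ α β γ)) = α - 2 * x 0 - x 1 * x 2 := by
      simp [cubic, pderiv_X]
      ring
    have h1 : eval x (pderiv 1 (cubic κ α β γ)) = β - 2 * x 1 - x 0 * x 2 := by
      simp [cubic, pderiv_X]
      ring
    have h2 : eval x (pderiv 2 (cubic κ α β γ)) = γ - 2 * x 2 - x 0 * x 1 := by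
      simp [cubic, pderiv_X]
    rw [IsCubicSingular, h, ← h0, ← h1, ← h2]
    refine and_congr_right fun _ => ⟨fun h => ⟨h 0, h 1, h 2⟩, fun h i => ?_⟩
    fin_cases i
    exacts [h.1, h.2.1, h.2.2]
  constructor
  · rintro ⟨x, hx⟩
    exact ⟨_, _, _, (key x).1 hx⟩
  · rintro ⟨x, y, z, h⟩
    exact ⟨![x, y, z], (key _).2 h⟩

/-- At a singular point, `z` is a double zero of the discriminant quartic of the conic fibration. -/
theorem IsCubicSingular.quartic {κ α β γ x y z : ℂ} (h : IsCubicSingular κ α β γ x y z) :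
    (κ + γ * z - z ^ 2) * (4 - z ^ 2) + α ^ 2 + β ^ 2 - z * α * β = 0 ∧
      (γ - 2 * z) * (4 - z ^ 2) - 2 * z * (κ + γ * z - z ^ 2) - α * β = 0 := by
  obtain ⟨h0, h1, h2, h3⟩ := h
  obtain rfl : α = 2 * x + y * z := by linear_combination h1
  obtain rfl : β = 2 * y + x * z := by linear_combination h2
  obtain rfl : γ = 2 * z + x * y := by linear_combination h3
  obtain rfl : κ = x ^ 2 + y ^ 2 + z ^ 2 + x * y * z - (2 * x + y * z) * x - (2 * y + x * z) * y -
    (2 * z + x * y) * z := by linear_combination h0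
  constructor <;> ring

/-- If the representation variety is singular, then `ψ₄` vanishes. -/
theorem psi4_eq_zero_of_singular (b : Fin 4 → ℂ) {x y z : ℂ}
    (h : IsCubicSingular (4 - b 0 ^ 2 - b 1 ^ 2 - b 2 ^ 2 - b 0 * b 1 * b 2 * b 3 - b 3 ^ 2)
      (b 0 * b 1 + b 2 * b 3) (b 0 * b 2 + b 1 * b 3) (b 1 * b 2 + b 0 * b 3) x y z) :
    psi4 b = 0 := by
  obtain ⟨h0, h1⟩ := h.quartic
  set p := z ^ 2 - b 1 * b 2 * z + (b 1 ^ 2 + b 2 ^ 2 - 4) with hp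
  set q := z ^ 2 - b 0 * b 3 * z + (b 0 ^ 2 + b 3 ^ 2 - 4) with hq
  -- For boundary traces the discriminant quartic factors as `p q`; `h3` says that the derivative of
  -- the product vanishes too.
  have h2 : p * q = 0 := by linear_combination h0
  have h3 : (2 * z - b 1 * b 2) * q + p * (2 * z - b 0 * b 3) = 0 := by linear_combination h1
  rw [psi4, Fin.prod_univ_four]
  by_cases hp0 : p = 0
  · rw [hp0, zero_mul, add_zero] at h3
    rcases mul_eq_zero.1 h3 with h4 | hq0
    · have h5 : (b 1 ^ 2 - 4) * (b 2 ^ 2 - 4) = 0 := by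
        linear_combination (-4) * hp0 + 4 * hp + (2 * z - b 1 * b 2) * h4
      linear_combination fourHoledDelta b ^ 2 * (b 0 ^ 2 - 4) * (b 3 ^ 2 - 4) * h5
    -- `Δ` is the resultant of `p` and `q`; the combination eliminates `z` using the linear
    -- polynomial `p - q`.
    · have h5 : fourHoledDelta b = 0 := by
        rw [hp] at hp0
        rw [hq] at hq0
        rw [fourHoledDelta]
        linear_combination (b 0 * b 3 - b 1 * b 2) ^ 2 * hp0 -
          ((b 0 * b 3 - b 1 * b 2) * z + (b 0 ^ 2 + b 3 ^ 2 - b 1 ^ 2 - b 2 ^ 2) -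
            b 1 * b 2 * (b 0 * b 3 - b 1 * b 2)) * (hp0 - hq0)
      rw [h5]
      ring
  · have hq0 : q = 0 := (mul_eq_zero.1 h2).resolve_left hp0
    rw [hq0, mul_zero, zero_add] at h3
    have h4 := (mul_eq_zero.1 h3).resolve_left hp0
    have h5 : (b 0 ^ 2 - 4) * (b 3 ^ 2 - 4) = 0 := by
      linear_combination (-4) * hq0 + 4 * hq + (2 * z - b 0 * b 3) * h4
    linear_combination fourHoledDelta b ^ 2 * (b 1 ^ 2 - 4) * (b 2 ^ 2 - 4) * h5

/-- The cubic surface has a singular point if a boundary trace is `±2`. -/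
theorem exists_isCubicSingular_of_sq_eq_four (p q r s : ℂ)
    (h : p ^ 2 = 4 ∨ q ^ 2 = 4 ∨ r ^ 2 = 4 ∨ s ^ 2 = 4) :
    ∃ x y z, IsCubicSingular (4 - p ^ 2 - q ^ 2 - r ^ 2 - p * q * r * s - s ^ 2)
      (p * q + r * s) (p * r + q * s) (q * r + p * s) x y z := by
  have h2 : ∀ t : ℂ, t ^ 2 = 4 → t = 2 ∨ t = -2 := fun t ht =>
    sq_eq_sq_iff_eq_or_eq_neg.1 (ht.trans (by norm_num))
  rcases h with h | h | h | h
  -- These are the traces of products when the boundary holonomy of trace `p = ±2` is `±1`; the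
  -- other cases are analogous.
  · refine ⟨p * q / 2, p * r / 2, p * s / 2, ?_⟩
    rcases h2 _ h with rfl | rfl <;> refine ⟨?_, ?_, ?_, ?_⟩ <;> ring
  · refine ⟨p * q / 2, q * s / 2, q * r / 2, ?_⟩
    rcases h2 _ h with rfl | rfl <;> refine ⟨?_, ?_, ?_, ?_⟩ <;> ring
  · refine ⟨r * s / 2, p * r / 2, q * r / 2, ?_⟩
    rcases h2 _ h with rfl | rfl <;> refine ⟨?_, ?_, ?_, ?_⟩ <;> ring
  · refine ⟨r * s / 2, q * s / 2, p * s / 2, ?_⟩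
    rcases h2 _ h with rfl | rfl <;> refine ⟨?_, ?_, ?_, ?_⟩ <;> ring

/-- The character of a diagonal representation is a singular point. -/
theorem exists_isCubicSingular_of_mul_eq_one {p q r s a b c d : ℂ} (ha : a ≠ 0) (hb : b ≠ 0)
    (hc : c ≠ 0) (hd : d ≠ 0) (hp : p = a + a⁻¹) (hq : q = b + b⁻¹) (hr : r = c + c⁻¹)
    (hs : s = d + d⁻¹) (h : a * b * c * d = 1) :
    ∃ x y z, IsCubicSingular (4 - p ^ 2 - q ^ 2 - r ^ 2 - p * q * r * s - s ^ 2)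
      (p * q + r * s) (p * r + q * s) (q * r + p * s) x y z := by
  obtain rfl : d = (a * b * c)⁻¹ := eq_inv_of_mul_eq_one_right h
  refine ⟨a * b + (a * b)⁻¹, a * c + (a * c)⁻¹, b * c + (b * c)⁻¹, ?_⟩
  subst hp hq hr hs
  refine ⟨?_, ?_, ?_, ?_⟩ <;> field_simp <;> ring

theorem exists_eq_add_inv (p : ℂ) : ∃ a : ℂ, a ≠ 0 ∧ p = a + a⁻¹ := by
  obtain ⟨a, ha⟩ := IsAlgClosed.exists_pow_nat_eq (p ^ 2 / 4 - 1) two_pos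
  have h : (p / 2 + a) * (p / 2 - a) = 1 := by linear_combination -ha
  refine ⟨p / 2 + a, left_ne_zero_of_mul_eq_one h, ?_⟩
  rw [← eq_inv_of_mul_eq_one_right h]
  ring

set_option maxRecDepth 4000 in
/-- The cubic surface has a singular point if `Δ` vanishes. -/
theorem exists_isCubicSingular_of_delta_eq_zero (p q r s : ℂ)
    (h : fourHoledDelta ![p, q, r, s] = 0) :
    ∃ x y z, IsCubicSingular (4 - p ^ 2 - q ^ 2 - r ^ 2 - p * q * r * s - s ^ 2)
      (p * q + r * s) (p * r + q * s) (q * r + p * s) x y z := by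
  obtain ⟨a, ha, hp⟩ := exists_eq_add_inv p
  obtain ⟨b, hb, hq⟩ := exists_eq_add_inv q
  obtain ⟨c, hc, hr⟩ := exists_eq_add_inv r
  obtain ⟨d, hd, hs⟩ := exists_eq_add_inv s
  -- Up to units the eight factors are `a b^± c^± d^± - 1`. Inverting an eigenvalue does not change
  -- its trace, so every case reduces to `abcd = 1`.
  have hprod : (a * b * c * d - 1) * (a * b * c - d) * (a * b * d - c) * (a * c * d - b) *
      (b * c * d - a) * (a * b - c * d) * (a * c - b * d) * (a * d - b * c) = 0 := by
    have : (a * b * c * d - 1) * (a * b * c - d) * (a * b * d - c) * (a * c * d - b) *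
        (b * c * d - a) * (a * b - c * d) * (a * c - b * d) * (a * d - b * c) =
        -(fourHoledDelta ![p, q, r, s] * (a * b * c * d) ^ 4) := by
      subst hp hq hr hs
      simp only [fourHoledDelta, Matrix.cons_val]
      field_simp
      ring
    rw [this, h, zero_mul, neg_zero]
  have hinv : ∀ {t w : ℂ}, t = w + w⁻¹ → t = w⁻¹ + w⁻¹⁻¹ := fun ht => by
    rw [inv_inv, add_comm]; exact ht
  simp only [mul_eq_zero, sub_eq_zero] at hprod
  rcases hprod with ((((((e | e) | e) | e) | e) | e) | e) | e
  · exact exists_isCubicSingular_of_mul_eq_one ha hb hc hd hp hq hr hs e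
  · exact exists_isCubicSingular_of_mul_eq_one ha hb hc (inv_ne_zero hd) hp hq hr (hinv hs)
      (by field_simp; linear_combination e)
  · exact exists_isCubicSingular_of_mul_eq_one ha hb (inv_ne_zero hc) hd hp hq (hinv hr) hs
      (by field_simp; linear_combination e)
  · exact exists_isCubicSingular_of_mul_eq_one ha (inv_ne_zero hb) hc hd hp (hinv hq) hr hs
      (by field_simp; linear_combination e)
  · exact exists_isCubicSingular_of_mul_eq_one (inv_ne_zero ha) hb hc hd (hinv hp) hq hr hs
      (by field_simp; linear_combination e)
  · exact exists_isCubicSingular_of_mul_eq_one ha hb (inv_ne_zero hc) (inv_ne_zero hd) hp hq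
      (hinv hr) (hinv hs) (by field_simp; linear_combination e)
  · exact exists_isCubicSingular_of_mul_eq_one ha (inv_ne_zero hb) hc (inv_ne_zero hd) hp (hinv hq)
      hr (hinv hs) (by field_simp; linear_combination e)
  · exact exists_isCubicSingular_of_mul_eq_one ha (inv_ne_zero hb) (inv_ne_zero hc) hd hp (hinv hq)
      (hinv hr) hs (by field_simp; linear_combination e)

theorem exists_singular_fourHoledPoly_iff (b : Fin 4 → ℂ) :
    (∃ x : Fin 3 → ℂ, eval x (fourHoledPoly b) = 0 ∧ ∀ i, eval x (pderiv i (fourHoledPoly b)) = 0) ↔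
      psi4 b = 0 := by
  rw [fourHoledPoly_eq_cubic, exists_singular_cubic_iff]
  constructor
  · rintro ⟨x, y, z, h⟩
    exact psi4_eq_zero_of_singular b h
  · intro h
    rw [psi4, mul_eq_zero, Fin.prod_univ_four] at h
    rcases h with h | h
    · refine exists_isCubicSingular_of_delta_eq_zero _ _ _ _ ?_
      rw [← pow_eq_zero_iff two_ne_zero, ← h]
      simp [fourHoledDelta]
    · simp only [mul_eq_zero, sub_eq_zero, or_assoc] at h
      exact exists_isCubicSingular_of_sq_eq_four _ _ _ _ h

/-- The representation variety `M_b` is smooth if and only if `ψ₄(b) ≠ 0`. -/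
theorem smooth_fourHoledRing_iff (b : Fin 4 → ℂ) :
    Algebra.Smooth ℂ (FourHoledRing b) ↔ psi4 b ≠ 0 := by
  have hu : fourHoledPoly b ≠ 0 := by
    rw [fourHoledPoly_eq_cubic]
    exact cubic_ne_zero _ _ _ _
  exact (smooth_quotient_span_iff hu).trans (not_congr (exists_singular_fourHoledPoly_iff b))

/-! # Moment functionals -/

section Moments

variable {E : Type*} [CommRing E]

/-- The `E`-linear functional on `E[ξ, η]` with prescribed moments. -/
noncomputable def momentFunctional (w : ℕ → ℕ → E) : MvPolynomial (Fin 2) E →ₗ[E] E :=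
  (basisMonomials (Fin 2) E).constr E fun s => w (s 0) (s 1)

theorem monomial_eq_C_mul_pow (s : Fin 2 →₀ ℕ) (e : E) :
    monomial s e = C e * (X 0 ^ s 0 * X 1 ^ s 1) := by
  rw [monomial_eq, Finsupp.prod_fintype _ _ (by simp), Fin.prod_univ_two]

theorem momentFunctional_apply (w : ℕ → ℕ → E) (e : E) (a b : ℕ) :
    momentFunctional w (C e * (X 0 ^ a * X 1 ^ b)) = e * w a b := by
  have h := (basisMonomials (Fin 2) E).constr_basis E
    (fun s : Fin 2 →₀ ℕ => w (s 0) (s 1)) (Finsupp.single 0 a + Finsupp.single 1 b)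
  rw [coe_basisMonomials] at h
  dsimp only at h
  rw [monomial_eq_C_mul_pow] at h
  simp only [Finsupp.add_apply, Finsupp.single_apply] at h
  rw [C_mul', map_smul, smul_eq_mul]
  change e * (basisMonomials (Fin 2) E).constr E (fun s : Fin 2 →₀ ℕ => w (s 0) (s 1)) _ = _
  congr 1
  simpa using h

theorem induction_on_C_mul_pow {P : MvPolynomial (Fin 2) E → Prop}
    (p : MvPolynomial (Fin 2) E) (mul_pow : ∀ e a b, P (C e * (X 0 ^ a * X 1 ^ b)))
    (add : ∀ p q, P p → P q → P (p + q)) : P p := by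
  induction p using MvPolynomial.induction_on' with
  | monomial s e => rw [monomial_eq_C_mul_pow]; exact mul_pow e _ _
  | add p q hp hq => exact add p q hp hq

variable {k : Type*} [CommRing k] [Algebra k E]

/-- The coefficientwise extension of a linear map to polynomials. -/
noncomputable def mapCoeffLinear (D : E →ₗ[k] E) :
    MvPolynomial (Fin 2) E →ₗ[k] MvPolynomial (Fin 2) E :=
  ((basisMonomials (Fin 2) E).repr.symm.toLinearMap.restrictScalars k) ∘ₗ
    Finsupp.mapRange.linearMap D ∘ₗ
    ((basisMonomials (Fin 2) E).repr.toLinearMap.restrictScalars k)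

theorem mapCoeffLinear_monomial (D : E →ₗ[k] E) (s : Fin 2 →₀ ℕ) (e : E) :
    mapCoeffLinear D (monomial s e) = monomial s (D e) := by
  have h : ∀ e : E, (basisMonomials (Fin 2) E).repr (monomial s e) = Finsupp.single s e := by
    intro e
    have := (basisMonomials (Fin 2) E).repr_self s
    rw [coe_basisMonomials] at this
    dsimp only at this
    rw [show monomial s e = e • monomial s (1 : E) by simp [smul_monomial], map_smul, this]
    simp
  simp only [mapCoeffLinear, LinearMap.comp_apply, LinearMap.restrictScalars_apply,
    LinearEquiv.coe_coe, h, Finsupp.mapRange.linearMap_apply, Finsupp.mapRange_single]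
  rw [← h, LinearEquiv.symm_apply_apply]

/-- The coefficientwise extension of a derivation to polynomials. -/
noncomputable def mapCoeffDerivation (D : Derivation k E E) :
    Derivation k (MvPolynomial (Fin 2) E) (MvPolynomial (Fin 2) E) :=
  Derivation.mk' (mapCoeffLinear D) (by
    intro p q
    simp only [smul_eq_mul]
    induction p using MvPolynomial.induction_on' with
    | monomial s a =>
      induction q using MvPolynomial.induction_on' with
      | monomial t b =>
        simp only [monomial_mul, mapCoeffLinear_monomial, Derivation.coeFn_coe, D.leibniz,
          smul_eq_mul, map_add, add_comm t s]
      | add q q' hq hq' => rw [mul_add, map_add, hq, hq', map_add]; ring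
    | add p p' hp hp' => rw [add_mul, map_add, hp, hp', map_add]; ring)

theorem mapCoeffDerivation_C_mul_pow (D : Derivation k E E) (e : E) (a b : ℕ) :
    mapCoeffDerivation D (C e * (X 0 ^ a * X 1 ^ b)) = C (D e) * (X 0 ^ a * X 1 ^ b) := by
  have h : (X 0 ^ a * X 1 ^ b : MvPolynomial (Fin 2) E) =
      monomial (Finsupp.single 0 a + Finsupp.single 1 b) 1 := by
    rw [monomial_eq_C_mul_pow]
    simp
  rw [h, C_mul_monomial, C_mul_monomial, mul_one, mul_one]
  exact mapCoeffLinear_monomial _ _ _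

theorem mapCoeffDerivation_C (D : Derivation k E E) (e : E) :
    mapCoeffDerivation D (C e) = C (D e) := by
  simpa using mapCoeffDerivation_C_mul_pow D e 0 0

theorem mapCoeffDerivation_X (D : Derivation k E E) (i : Fin 2) :
    mapCoeffDerivation D (X i) = 0 := by
  fin_cases i
  · simpa using mapCoeffDerivation_C_mul_pow D 1 1 0
  · simpa using mapCoeffDerivation_C_mul_pow D 1 0 1

/-- A derivation along an algebra homomorphism that restricts to `∂ᵢ` on the variables. -/
theorem derivation_algHom_eq {σ : Type*} {A : Type*} [CommRing A] [Algebra k A]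
    (θ : MvPolynomial σ k →ₐ[k] A) (T : Derivation k A A) (i : σ)
    (h : ∀ j, T (θ (X j)) = θ (pderiv i (X j))) (p : MvPolynomial σ k) :
    T (θ p) = θ (pderiv i p) := by
  induction p using MvPolynomial.induction_on with
  | C a => rw [← algebraMap_eq, AlgHom.commutes]; simp
  | add p q hp hq => simp only [map_add, hp, hq]
  | mul_X p j hp => simp only [map_mul, Derivation.leibniz, smul_eq_mul, map_add, hp, h]

/-! The moments `ξᵃ ηᵇ ↦ δ_{ab} cᵃ / (a + 1)` of the conic `ξ η = c`. -/

variable [Algebra ℂ E]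

/-- The image of `1 / (a + 1)` in `E`. -/
noncomputable def invSucc (E : Type*) [CommRing E] [Algebra ℂ E] (a : ℕ) : E :=
  algebraMap ℂ E ((a : ℂ) + 1)⁻¹

theorem invSucc_mul (a : ℕ) : invSucc E a * (a + 1) = 1 := by
  rw [invSucc, ← map_natCast (algebraMap ℂ E), ← map_one (algebraMap ℂ E), ← map_add, ← map_mul,
    inv_mul_cancel₀ (Nat.cast_add_one_ne_zero a)]

theorem invSucc_sub (a : ℕ) : invSucc E a - invSucc E (a + 1) = invSucc E a * invSucc E (a + 1) := by
  have h1 := invSucc_mul (E := E) a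
  have h2 := invSucc_mul (E := E) (a + 1)
  push_cast at h2
  linear_combination invSucc E (a + 1) * h1 - invSucc E a * h2

theorem derivation_invSucc (D : Derivation ℂ E E) (a : ℕ) : D (invSucc E a) = 0 :=
  D.map_algebraMap _

/-- Normalised integration over the disc bounded by the conic `ξ η = c`. -/
noncomputable def conicMean (c : E) : MvPolynomial (Fin 2) E →ₗ[E] E :=
  momentFunctional fun a b => if a = b then invSucc E a * c ^ a else 0

/-- Normalised integration over the disc bounded by the conic `ξ η = c` with weight
`(c - ξ η) / c`. -/
noncomputable def conicWeightedMean (c : E) : MvPolynomial (Fin 2) E →ₗ[E] E :=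
  momentFunctional fun a b => if a = b then invSucc E a * invSucc E (a + 1) * c ^ a else 0

variable (c : E)

theorem conicMean_C_mul (e : E) (p : MvPolynomial (Fin 2) E) :
    conicMean c (C e * p) = e * conicMean c p := by
  rw [C_mul', map_smul, smul_eq_mul]

theorem conicMean_C_mul_pow (e : E) (a b : ℕ) : conicMean c (C e * (X 0 ^ a * X 1 ^ b)) =
    e * if a = b then invSucc E a * c ^ a else 0 :=
  momentFunctional_apply _ _ _ _

/-- Stokes' theorem: `c - ξη` vanishes on the boundary conic. On diagonal monomials it is the
cancellation `(a + 1) c · cᵃ/(a + 1) = (a + 2) · cᵃ⁺¹/(a + 2)`. -/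
theorem conicMean_pderiv (i : Fin 2) (p : MvPolynomial (Fin 2) E) :
    conicMean c (pderiv i ((C c - X 0 * X 1) * p)) = 0 := by
  induction p using induction_on_C_mul_pow with
  | add p q hp hq => rw [mul_add, map_add, map_add, hp, hq, add_zero]
  | mul_pow e a b =>
  fin_cases i
  · rcases a with _ | a
    · have : pderiv 0 ((C c - X 0 * X 1 : MvPolynomial (Fin 2) E) * (C e * (X 0 ^ 0 * X 1 ^ b))) =
          C (-e) * (X 0 ^ 0 * X 1 ^ (b + 1)) := by
        simp [pderiv_X]
        ring
      simp only [Fin.zero_eta, this, conicMean_C_mul_pow]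
      simp
    · have : pderiv 0 ((C c - X 0 * X 1 : MvPolynomial (Fin 2) E) * (C e * (X 0 ^ (a + 1) * X 1 ^ b))) =
          C ((a + 1) * c * e) * (X 0 ^ a * X 1 ^ b) -
            C ((a + 1 + 1) * e) * (X 0 ^ (a + 1) * X 1 ^ (b + 1)) := by
        simp [pderiv_X]
        ring
      have h1 := invSucc_mul (E := E) a
      have h2 := invSucc_mul (E := E) (a + 1)
      push_cast at h2
      simp only [Fin.zero_eta, this, map_sub, conicMean_C_mul_pow, add_left_inj]
      split_ifs
      · linear_combination c ^ (a + 1) * e * (h1 - h2)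
      · ring
  · rcases b with _ | b
    · have : pderiv 1 ((C c - X 0 * X 1 : MvPolynomial (Fin 2) E) * (C e * (X 0 ^ a * X 1 ^ 0))) =
          C (-e) * (X 0 ^ (a + 1) * X 1 ^ 0) := by
        simp [pderiv_X]
        ring
      simp only [Fin.mk_one, this, conicMean_C_mul_pow]
      simp
    · have : pderiv 1 ((C c - X 0 * X 1 : MvPolynomial (Fin 2) E) * (C e * (X 0 ^ a * X 1 ^ (b + 1)))) =
          C ((b + 1) * c * e) * (X 0 ^ a * X 1 ^ b) -
            C ((b + 1 + 1) * e) * (X 0 ^ (a + 1) * X 1 ^ (b + 1)) := by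
        simp [pderiv_X]
        ring
      have h1 := invSucc_mul (E := E) b
      have h2 := invSucc_mul (E := E) (b + 1)
      push_cast at h2
      simp only [Fin.mk_one, this, map_sub, conicMean_C_mul_pow, add_left_inj]
      split_ifs with hab
      · subst hab
        linear_combination c ^ (a + 1) * e * (h1 - h2)
      · ring

theorem conicMean_mul (p : MvPolynomial (Fin 2) E) :
    conicMean c ((C c - X 0 * X 1) * p) = c * conicWeightedMean c p := by
  induction p using induction_on_C_mul_pow with
  | add p q hp hq => rw [mul_add, map_add, map_add, hp, hq, mul_add]
  | mul_pow e a b =>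
  rw [conicWeightedMean, momentFunctional_apply]
  have : (C c - X 0 * X 1 : MvPolynomial (Fin 2) E) * (C e * (X 0 ^ a * X 1 ^ b)) =
      C (c * e) * (X 0 ^ a * X 1 ^ b) -
      C e * (X 0 ^ (a + 1) * X 1 ^ (b + 1)) := by
    rw [C_mul]
    ring
  simp only [this, map_sub, conicMean_C_mul_pow, add_left_inj]
  split_ifs
  · linear_combination c ^ (a + 1) * e * invSucc_sub (E := E) a
  · ring

/-- Differentiation under the integral sign: `c * conicMean c` is the unnormalised integral, and the
integrand vanishes on the moving boundary, so no boundary term appears. -/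
theorem conicMean_mapCoeffDerivation (D : Derivation ℂ E E) (p : MvPolynomial (Fin 2) E) :
    c * conicMean c (mapCoeffDerivation D ((C c - X 0 * X 1) * p)) =
      D (c * conicMean c ((C c - X 0 * X 1) * p)) := by
  induction p using induction_on_C_mul_pow with
  | add p q hp hq => rw [mul_add, map_add, map_add, map_add, mul_add, mul_add, map_add, hp, hq]
  | mul_pow e a b =>
  have : (C c - X 0 * X 1 : MvPolynomial (Fin 2) E) * (C e * (X 0 ^ a * X 1 ^ b)) =
      C (c * e) * (X 0 ^ a * X 1 ^ b) -
      C e * (X 0 ^ (a + 1) * X 1 ^ (b + 1)) := by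
    rw [C_mul]
    ring
  simp only [this, map_sub, mapCoeffDerivation_C_mul_pow, conicMean_C_mul_pow, add_left_inj]
  split_ifs
  · have h2 := invSucc_mul (E := E) (a + 1)
    push_cast at h2
    have h3 := invSucc_sub (E := E) a
    have h4 : c * (c * e * (invSucc E a * c ^ a) - e * (invSucc E (a + 1) * c ^ (a + 1))) =
        invSucc E a * invSucc E (a + 1) * (e * c ^ (a + 2)) := by
      linear_combination c ^ (a + 2) * e * h3
    rw [h4]
    simp only [Derivation.leibniz, Derivation.leibniz_pow, derivation_invSucc, smul_eq_mul,
      nsmul_eq_mul, mul_zero, add_zero]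
    push_cast
    linear_combination c ^ (a + 2) * D e * h3 - e * c ^ (a + 1) * D c * invSucc E a * h2
  · simp

end Moments

/-! # The conic fibration of the cubic surface -/

section ConicFibration

variable {E : Type*} [CommRing E] [Algebra ℂ E]

/-- A parameter `v` with inverse, an inverse of `v - v⁻¹`, and a derivation `D` with `D v = v`. The
conic bundle `x₁ = v + v⁻¹` of the cubic surface splits after adjoining `v`. -/
structure ConicParameter (E : Type*) [CommRing E] [Algebra ℂ E] where
  /-- The parameter. -/
  v : E
  /-- Its inverse. -/
  w : E
  /-- The inverse of `v - w`. -/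
  s : E
  /-- The derivation `v d/dv`. -/
  D : Derivation ℂ E E
  mul_w : v * w = 1
  mul_s : (v - w) * s = 1
  D_v : D v = v

namespace ConicParameter

variable (π : ConicParameter E)

theorem D_w : π.D π.w = -π.w := by
  have h := congrArg π.D π.mul_w
  rw [π.D.leibniz, π.D_v, π.D.map_one_eq_zero, smul_eq_mul, smul_eq_mul] at h
  linear_combination π.w * h - (π.D π.w + π.w) * π.mul_w

theorem D_s : π.D π.s = -((π.v + π.w) * π.s ^ 2) := by
  have h := congrArg π.D π.mul_s
  rw [π.D.leibniz, map_sub, π.D_v, π.D_w, π.D.map_one_eq_zero, smul_eq_mul, smul_eq_mul] at h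
  linear_combination π.s * h - (π.D π.s) * π.mul_s

variable (κ α β γ : ℂ)

/-- The first coordinate of the centre of the conic. -/
def center₁ : E :=
  -(π.s ^ 2 * (2 * algebraMap ℂ E β - (π.v + π.w) * algebraMap ℂ E γ))

/-- The second coordinate of the centre of the conic. -/
def center₂ : E :=
  -(π.s ^ 2 * (2 * algebraMap ℂ E γ - (π.v + π.w) * algebraMap ℂ E β))

/-- The centre is where `∂₂u` and `∂₃u` vanish for fixed `x₁ = v + w`. The determinant of this
linear system is `4 - (v + w)² = -(v - w)²`, whence the factor `s²`. -/
theorem center_eq₁ :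
    2 * π.center₁ β γ + (π.v + π.w) * π.center₂ β γ = algebraMap ℂ E β := by
  have h := π.mul_s
  have h' := π.mul_w
  rw [center₁, center₂]
  linear_combination (algebraMap ℂ E β) * ((π.v - π.w) * π.s + 1) * h +
    4 * π.s ^ 2 * algebraMap ℂ E β * h'

theorem center_eq₂ :
    2 * π.center₂ β γ + (π.v + π.w) * π.center₁ β γ = algebraMap ℂ E γ := by
  have h := π.mul_s
  have h' := π.mul_w
  rw [center₁, center₂]
  linear_combination (algebraMap ℂ E γ) * ((π.v - π.w) * π.s + 1) * h +
    4 * π.s ^ 2 * algebraMap ℂ E γ * h'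

/-- The value of the cubic at the centre of the conic. -/
noncomputable def radius : E :=
  algebraMap ℂ E κ + algebraMap ℂ E α * (π.v + π.w) - (π.v + π.w) ^ 2 +
    algebraMap ℂ E (1 / 2) *
      (algebraMap ℂ E β * π.center₁ β γ + algebraMap ℂ E γ * π.center₂ β γ)

/-- The coordinate change splitting the conics. -/
noncomputable def split : MvPolynomial (Fin 3) ℂ →ₐ[ℂ] MvPolynomial (Fin 2) E :=
  aeval ![C (π.v + π.w), C (π.center₁ β γ) + C π.s * (C π.v * X 1 - C π.w * X 0),
    C (π.center₂ β γ) + C π.s * (X 0 - X 1)]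

theorem split_X0 : π.split β γ (X 0) = C (π.v + π.w) := by simp [split]

theorem split_X1 : π.split β γ (X 1) =
    C (π.center₁ β γ) + C π.s * (C π.v * X 1 - C π.w * X 0) := by simp [split]

theorem split_X2 : π.split β γ (X 2) = C (π.center₂ β γ) + C π.s * (X 0 - X 1) := by simp [split]

theorem C_mul_w : (C π.v * C π.w : MvPolynomial (Fin 2) E) = 1 := by
  rw [← C_mul, π.mul_w, C_1]

theorem C_mul_s : ((C π.v - C π.w) * C π.s : MvPolynomial (Fin 2) E) = 1 := by
  rw [← C_sub, ← C_mul, π.mul_s, C_1]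

theorem split_C (a : ℂ) : π.split β γ (C a) = C (algebraMap ℂ E a) := by
  rw [← algebraMap_eq, AlgHom.commutes]
  rfl

/-- The quadratic part factors as `(x₂ + v x₃)(x₂ + w x₃)`. Relative to the centre, the two factors
are the coordinates `ξ = X 0` and `η = X 1`, as `hξ` and `hη` record. -/
theorem split_cubic : π.split β γ (cubic κ α β γ) = C (π.radius κ α β γ) - X 0 * X 1 := by
  have h1 : (C (algebraMap ℂ E β) : MvPolynomial (Fin 2) E) =
      2 * C (π.center₁ β γ) + (C π.v + C π.w) * C (π.center₂ β γ) := by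
    rw [← center_eq₁ π β γ]; simp [map_ofNat C 2]
  have h2 : (C (algebraMap ℂ E γ) : MvPolynomial (Fin 2) E) =
      2 * C (π.center₂ β γ) + (C π.v + C π.w) * C (π.center₁ β γ) := by
    rw [← center_eq₂ π β γ]; simp [map_ofNat C 2]
  have h3 := π.C_mul_w
  have h4 := π.C_mul_s
  have h5 : (2 * C (algebraMap ℂ E (1 / 2)) : MvPolynomial (Fin 2) E) = 1 := by
    rw [← map_ofNat (C : E →+* MvPolynomial (Fin 2) E) 2, ← map_ofNat (algebraMap ℂ E) 2, ← C_mul,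
      ← map_mul]
    norm_num
  have hξ : (C π.s * (C π.v * X 1 - C π.w * X 0) + C π.v * (C π.s * (X 0 - X 1)) :
      MvPolynomial (Fin 2) E) = X 0 := by linear_combination X 0 * h4
  have hη : (C π.s * (C π.v * X 1 - C π.w * X 0) + C π.w * (C π.s * (X 0 - X 1)) :
      MvPolynomial (Fin 2) E) = X 1 := by linear_combination X 1 * h4
  simp only [cubic, map_add, map_sub, map_mul, map_pow, split_X0, split_X1, split_X2, split_C,
    radius]
  rw [h1, h2]
  generalize (C π.s * (C π.v * X 1 - C π.w * X 0) : MvPolynomial (Fin 2) E) = y at *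
  generalize (C π.s * (X 0 - X 1) : MvPolynomial (Fin 2) E) = y' at *
  generalize (C (π.center₁ β γ) : MvPolynomial (Fin 2) E) = p at *
  generalize (C (π.center₂ β γ) : MvPolynomial (Fin 2) E) = q at *
  rw [← hξ, ← hη]
  linear_combination y' ^ 2 * h3 - (p ^ 2 + q ^ 2 + (C π.v + C π.w) * p * q) * h5

/-- The vector field on the `(ξ, η)`-plane compensating `D`, with components given here. -/
noncomputable def drift : Fin 2 → MvPolynomial (Fin 2) E :=
  ![C (π.v * π.s) * (X 0 - X 1) - C (π.D (π.center₁ β γ) + π.v * π.D (π.center₂ β γ)),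
    C (π.w * π.s) * (X 1 - X 0) - C (π.D (π.center₁ β γ) + π.w * π.D (π.center₂ β γ))]

/-- The derivations of `E[ξ, η]` corresponding to the partial derivatives of `ℂ[x₁, x₂, x₃]`. -/
noncomputable def lift :
    Fin 3 → Derivation ℂ (MvPolynomial (Fin 2) E) (MvPolynomial (Fin 2) E) :=
  ![(C π.s : MvPolynomial (Fin 2) E) • (mapCoeffDerivation π.D +
      ((π.drift β γ 0) • (pderiv 0).restrictScalars ℂ +
        (π.drift β γ 1) • (pderiv 1).restrictScalars ℂ)),
    (pderiv 0).restrictScalars ℂ + (pderiv 1).restrictScalars ℂ,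
    (C π.v : MvPolynomial (Fin 2) E) • (pderiv 0).restrictScalars ℂ +
      (C π.w : MvPolynomial (Fin 2) E) • (pderiv 1).restrictScalars ℂ]

theorem lift0_apply (p : MvPolynomial (Fin 2) E) : π.lift β γ 0 p =
    C π.s * (mapCoeffDerivation π.D p + (π.drift β γ 0 * pderiv 0 p +
      π.drift β γ 1 * pderiv 1 p)) := rfl

theorem lift1_apply (p : MvPolynomial (Fin 2) E) : π.lift β γ 1 p = pderiv 0 p + pderiv 1 p := rfl

theorem lift2_apply (p : MvPolynomial (Fin 2) E) : π.lift β γ 2 p =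
    C π.v * pderiv 0 p + C π.w * pderiv 1 p := rfl

/-- Chain rule. Since `dx₁ = (v - w) dv/v`, `∂₁` is `s D` taken at fixed `x₂, x₃`; there `ξ` and `η`
vary with `v`, which is what `drift` records. -/
theorem lift_split (i : Fin 3) (p : MvPolynomial (Fin 3) ℂ) :
    π.lift β γ i (π.split β γ p) = π.split β γ (pderiv i p) := by
  refine derivation_algHom_eq _ _ _ (fun j => ?_) p
  have h3 := π.C_mul_w
  have h4 := π.C_mul_s
  fin_cases i <;> fin_cases j <;>
    simp only [Fin.zero_eta, Fin.mk_one, Fin.reduceFinMk, split_X0, split_X1, split_X2,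
      lift0_apply, lift1_apply, lift2_apply, map_add, map_sub, Derivation.leibniz, smul_eq_mul,
      mapCoeffDerivation_C, mapCoeffDerivation_X, D_v, D_w, D_s, pderiv_X, pderiv_C, drift]
  all_goals simp
  · linear_combination h4
  · linear_combination (-(C π.s * C (π.D (π.center₁ β γ))) -
      C π.s ^ 2 * (X 1 * C π.v + X 0 * C π.w)) * h4
  · linear_combination (-(C π.s * C (π.D (π.center₂ β γ)))) * h4
  · linear_combination h4
  · ring
  · linear_combination h4

/-- The relative fundamental identity: on divergences of multiples of the cubic, the mean over the
conics is an exact differential. -/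
theorem radius_mul_conicMean_divMul (h : Fin 3 → MvPolynomial (Fin 3) ℂ) :
    π.radius κ α β γ * conicMean (π.radius κ α β γ)
        (π.split β γ (divMul (cubic κ α β γ) h)) =
      π.D (π.s * π.radius κ α β γ ^ 2 *
        conicWeightedMean (π.radius κ α β γ) (π.split β γ (h 0))) := by
  set c := π.radius κ α β γ with hc
  have hT : ∀ i, π.split β γ (pderiv i (cubic κ α β γ * h i)) =
      π.lift β γ i ((C c - X 0 * X 1) * π.split β γ (h i)) := fun i => by
    rw [← lift_split, map_mul, split_cubic]
  rw [divMul_apply, Fin.sum_univ_three, map_add, map_add, map_add, map_add, hT, hT, hT]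
  -- `∂₂` and `∂₃` differentiate along the fibre only, so their means vanish.
  have h1 : conicMean c (π.lift β γ 1 ((C c - X 0 * X 1) * π.split β γ (h 1))) = 0 := by
    rw [lift1_apply, map_add, conicMean_pderiv, conicMean_pderiv, add_zero]
  have h2 : conicMean c (π.lift β γ 2 ((C c - X 0 * X 1) * π.split β γ (h 2))) = 0 := by
    rw [lift2_apply, map_add, conicMean_C_mul, conicMean_C_mul, conicMean_pderiv, conicMean_pderiv]
    ring
  rw [h1, h2, add_zero, add_zero]
  set f := π.split β γ (h 0) with hf
  set F := (C c - X 0 * X 1) * f with hF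
  have hd0 : pderiv 0 (π.drift β γ 0) = C (π.v * π.s) := by
    simp [drift, pderiv_X]
  have hd1 : pderiv 1 (π.drift β γ 1) = C (π.w * π.s) := by
    simp [drift, pderiv_X]
  -- Integration by parts: the drift has divergence `(v + w) s`, constant on the fibre. This is
  -- exactly the term supplied by `D s = -(v + w) s²` in the final product rule.
  have hi : ∀ (i : Fin 2) (a : MvPolynomial (Fin 2) E) (e : E), pderiv i a = C e →
      conicMean c (a * pderiv i F) = -(e * conicMean c F) := by
    intro i a e ha
    have h3 := conicMean_pderiv c i (a * f)
    have h4 : pderiv i ((C c - X 0 * X 1) * (a * f)) = a * pderiv i F + C e * F := by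
      rw [← ha, mul_left_comm, ← hF, Derivation.leibniz, smul_eq_mul, smul_eq_mul]
      ring
    rw [h4, map_add, conicMean_C_mul] at h3
    linear_combination h3
  have hD := conicMean_mapCoeffDerivation c π.D f
  rw [← hF] at hD
  have hm : c * conicMean c F = c ^ 2 * conicWeightedMean c f := by
    rw [hF, conicMean_mul]
    ring
  rw [lift0_apply, conicMean_C_mul, map_add, map_add, hi 0 _ _ hd0, hi 1 _ _ hd1, mul_assoc π.s,
    ← hm, π.D.leibniz, ← hD, D_s, smul_eq_mul, smul_eq_mul]
  ring

/-- The basis polynomials have degree at most one in `x₂, x₃`, so their means are their values at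
the centre. -/
theorem conicMean_split_basisPoly (a : Fin 5 → ℂ) (c : E) :
    conicMean c (π.split β γ (∑ j, a j • basisPoly ℂ j)) =
      algebraMap ℂ E (a 0) + algebraMap ℂ E (a 1) * (π.v + π.w) +
        algebraMap ℂ E (a 2) * π.center₁ β γ + algebraMap ℂ E (a 3) * π.center₂ β γ +
        algebraMap ℂ E (a 4) * (π.v + π.w) ^ 2 := by
  have h00 : ∀ e : E, conicMean c (C e) = e := fun e => by
    simpa [invSucc] using conicMean_C_mul_pow c e 0 0
  have h10 : conicMean c (X 0) = 0 := by
    simpa using conicMean_C_mul_pow c 1 1 0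
  have h01 : conicMean c (X 1) = 0 := by
    simpa using conicMean_C_mul_pow c 1 0 1
  have h1 : conicMean c (1 : MvPolynomial (Fin 2) E) = 1 := by
    rw [← C_1, h00]
  simp only [Fin.sum_univ_five, basisPoly, Matrix.cons_val, map_add, ← C_mul', map_mul, split_C,
    conicMean_C_mul, map_one, map_pow, split_X0, split_X1, split_X2, map_sub, h00, h10, h01, h1]
  simp only [← C_add, ← C_pow, h00]
  ring

end ConicParameter

end ConicFibration

/-! # Exact rational differentials with prescribed poles -/

section Wronskian

variable {K : Type*} [Field K] [CharZero K]

/-- The numerator of the derivative of `H / T ^ N`, up to a power of `T`. -/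
noncomputable def quotNumerator (H T : Polynomial K) (N : ℕ) : Polynomial K :=
  Polynomial.derivative H * T - N * Polynomial.derivative T * H

/-- If `H` vanishes to order `j < N` at `r`, then `H / (L T)^N`, with `L` the linear factor at `r`,
has a genuine pole there, and the numerator of its derivative has order exactly `j` because `j - N ≠
0`. -/
theorem pow_dvd_of_dvd_quotNumerator {r : K} {T H S : Polynomial K} {N s : ℕ} (hs : 1 ≤ s)
    (hT : T.eval r ≠ 0) (hS : S.eval r ≠ 0) (hH : H ≠ 0)
    (h : (Polynomial.X - Polynomial.C r) ^ (N + 1) ∣ (Polynomial.X - Polynomial.C r) ^ s *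
      (S * quotNumerator H ((Polynomial.X - Polynomial.C r) * T) N)) :
    (Polynomial.X - Polynomial.C r) ^ (N + 1 - s) ∣ H := by
  obtain ⟨G, hG, hGr⟩ := Polynomial.exists_eq_pow_rootMultiplicity_mul_and_not_dvd H hH r
  set j := H.rootMultiplicity r
  set L := Polynomial.X - Polynomial.C r with hL
  rcases le_or_gt (N + 1 - s) j with hj | hj
  · exact (pow_dvd_pow L hj).trans ⟨G, hG⟩
  exfalso
  have hjN : j < N := by omega
  have hw : quotNumerator H (L * T) N = L ^ j * (((j : Polynomial K) - N) * T * G +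
      L * (Polynomial.derivative G * T - N * Polynomial.derivative T * G)) := by
    have hd : Polynomial.derivative L = 1 := by simp [hL]
    rw [quotNumerator, hG]
    rcases Nat.eq_zero_or_pos j with h0 | h0
    · rw [h0]
      simp only [Polynomial.derivative_mul, hd, pow_zero, one_mul, Nat.cast_zero]
      ring
    · obtain ⟨i, hi⟩ := Nat.exists_eq_succ_of_ne_zero h0.ne'
      rw [hi]
      simp only [Polynomial.derivative_mul, hd, Polynomial.derivative_pow, Nat.succ_eq_add_one,
        Nat.add_sub_cancel, map_natCast]
      push_cast
      ring
  rw [hw, show ∀ A : Polynomial K, L ^ s * (S * (L ^ j * A)) = L ^ (s + j) * (S * A) by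
    intro A; ring] at h
  have hL0 : L ≠ 0 := Polynomial.X_sub_C_ne_zero r
  have h1 : L ^ (s + j) * L ∣ L ^ (s + j) * (S * (((j : Polynomial K) - N) * T * G +
      L * (Polynomial.derivative G * T - N * Polynomial.derivative T * G))) := by
    rw [← pow_succ]
    exact (pow_dvd_pow L (by omega)).trans h
  have h2 := (mul_dvd_mul_iff_left (pow_ne_zero _ hL0)).1 h1
  rw [hL, Polynomial.dvd_iff_isRoot, Polynomial.IsRoot] at h2
  have h3 : G.eval r ≠ 0 := fun h => hGr (Polynomial.dvd_iff_isRoot.2 h)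
  have h4 : (j : K) - N ≠ 0 := sub_ne_zero.2 (by exact_mod_cast hjN.ne)
  simp [hS, hT, h3, h4] at h2

/-- The leading coefficient is multiplied by `deg H - 3N`, which is nonzero. -/
theorem natDegree_quotNumerator {H T : Polynomial K} {N : ℕ}
    (hT : T = Polynomial.X ^ 3 - Polynomial.X) (hH : 3 * N < H.natDegree) :
    H.natDegree + 2 ≤ (quotNumerator H T N).natDegree := by
  refine Polynomial.le_natDegree_of_ne_zero ?_
  obtain ⟨n, hn⟩ : ∃ n, H.natDegree = n + 1 := Nat.exists_eq_succ_of_ne_zero (by omega)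
  have hw : quotNumerator H T N = Polynomial.derivative H * Polynomial.X ^ 3 -
      Polynomial.derivative H * Polynomial.X -
      Polynomial.C (3 * N : K) * (H * Polynomial.X ^ 2) + Polynomial.C (N : K) * H := by
    rw [quotNumerator, hT]
    simp [map_ofNat Polynomial.C 2, map_ofNat Polynomial.C 3]
    ring
  have h1 : H.coeff (n + 3) = 0 := Polynomial.coeff_eq_zero_of_natDegree_lt (by omega)
  have h2 : H.leadingCoeff = H.coeff (n + 1) := by rw [Polynomial.leadingCoeff, hn]
  have h3 : H ≠ 0 := by
    rintro rfl
    simp at hn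
  rw [hw, hn]
  have e3 : n + 1 + 2 = n + 3 := rfl
  rw [Polynomial.coeff_add, Polynomial.coeff_sub, Polynomial.coeff_sub, Polynomial.coeff_C_mul,
    Polynomial.coeff_C_mul, e3, Polynomial.coeff_mul_X_pow, show n + 3 = (n + 2) + 1 from rfl,
    Polynomial.coeff_mul_X, show n + 2 + 1 = (n + 1) + 2 from rfl, Polynomial.coeff_mul_X_pow,
    Polynomial.coeff_derivative, Polynomial.coeff_derivative, h1]
  have h4 : (n : K) + 1 - 3 * N ≠ 0 := by
    rw [sub_ne_zero]
    exact_mod_cast (by omega : n + 1 ≠ 3 * N)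
  have h5 : H.coeff (n + 1) ≠ 0 := h2 ▸ Polynomial.leadingCoeff_ne_zero.2 h3
  convert mul_ne_zero h5 h4 using 1
  ring

/-- A rational function with poles at `0, ±1, ∞` whose numerator is divisible by `Q ^ 2` vanishes if
its logarithmic derivation has poles of order at most four. -/
theorem eq_zero_of_quotNumerator_eq {H M Q : Polynomial K} {N : ℕ} (hN : 4 ≤ N)
    (hM : M.natDegree ≤ 16) (hQ : Q.natDegree = 8) (hQ0 : Q.eval 0 ≠ 0) (hQ1 : Q.eval 1 ≠ 0)
    (hQ2 : Q.eval (-1) ≠ 0) (hdvd : Q ^ 2 ∣ H)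
    (h : Polynomial.X ^ 5 * ((Polynomial.X ^ 2 - 1) ^ 4 *
      quotNumerator H (Polynomial.X ^ 3 - Polynomial.X) N) =
      M * (Polynomial.X ^ 3 - Polynomial.X) ^ (N + 1)) : H = 0 := by
  by_contra hH
  set X : Polynomial K := Polynomial.X with hX
  have hT : X ^ 3 - X = X * (X - 1) * (X + 1) := by ring
  -- With `R = H / T ^ N`, the logarithmic derivative `v dR/dv` has poles of order at most four at
  -- `0, ±1, ∞`. Hence `R` has poles of order at most `4` at `0` and `3` at `±1`. The factor `Q²`
  -- adds `16` zeros, forcing order at least `16 - 10 = 6` at infinity, where at most `4` is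
  -- allowed.
  have c0 : X - Polynomial.C 0 = X := by simp
  have c1 : X - Polynomial.C 1 = X - 1 := by simp
  have c2 : X - Polynomial.C (-1) = X + 1 := by simp
  have d0 : X ^ (N + 1 - 5) ∣ H := by
    have := pow_dvd_of_dvd_quotNumerator (r := 0) (T := X ^ 2 - 1) (H := H)
      (S := (X ^ 2 - 1) ^ 4) (N := N) (s := 5) (by norm_num) (by simp [hX]) (by simp [hX]) hH
    rw [c0] at this
    refine this ?_
    rw [show X * (X ^ 2 - 1) = X ^ 3 - X by ring, h, hT, mul_pow, mul_pow]
    exact ⟨M * ((X - 1) ^ (N + 1) * (X + 1) ^ (N + 1)), by ring⟩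
  have d1 : (X - 1) ^ (N + 1 - 4) ∣ H := by
    have := pow_dvd_of_dvd_quotNumerator (r := 1) (T := X ^ 2 + X) (H := H)
      (S := X ^ 5 * (X + 1) ^ 4) (N := N) (s := 4) (by norm_num) (by simp [hX])
      (by simp [hX]) hH
    rw [c1] at this
    refine this ?_
    rw [show (X - 1) * (X ^ 2 + X) = X ^ 3 - X by ring,
      show ∀ A : Polynomial K, (X - 1) ^ 4 * (X ^ 5 * (X + 1) ^ 4 * A) =
        X ^ 5 * ((X ^ 2 - 1) ^ 4 * A) by intro A; ring, h, hT, mul_pow, mul_pow]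
    exact ⟨M * (X ^ (N + 1) * (X + 1) ^ (N + 1)), by ring⟩
  have d2 : (X + 1) ^ (N + 1 - 4) ∣ H := by
    have := pow_dvd_of_dvd_quotNumerator (r := -1) (T := X ^ 2 - X) (H := H)
      (S := X ^ 5 * (X - 1) ^ 4) (N := N) (s := 4) (by norm_num) (by simp [hX])
      (by simp [hX]; norm_num) hH
    rw [c2] at this
    refine this ?_
    rw [show (X + 1) * (X ^ 2 - X) = X ^ 3 - X by ring,
      show ∀ A : Polynomial K, (X + 1) ^ 4 * (X ^ 5 * (X - 1) ^ 4 * A) =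
        X ^ 5 * ((X ^ 2 - 1) ^ 4 * A) by intro A; ring, h, hT, mul_pow, mul_pow]
    exact ⟨M * (X ^ (N + 1) * (X - 1) ^ (N + 1)), by ring⟩
  have cop : ∀ r : K, Q.eval r ≠ 0 → IsCoprime (X - Polynomial.C r) Q := fun r hr =>
    ((Polynomial.irreducible_X_sub_C r).coprime_iff_not_dvd).2
      fun hd => hr (Polynomial.dvd_iff_isRoot.1 hd)
  have cp : ∀ r s : K, r ≠ s → IsCoprime (X - Polynomial.C r) (X - Polynomial.C s) := fun r s hrs =>
    Polynomial.isCoprime_X_sub_C_of_isUnit_sub (sub_ne_zero.2 hrs).isUnit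
  have q0 := cop 0 hQ0
  have q1 := cop 1 hQ1
  have q2 := cop (-1) hQ2
  have p01 := cp 0 1 zero_ne_one
  have p02 := cp 0 (-1) (by norm_num)
  have p12 := cp 1 (-1) (by norm_num)
  rw [c0] at q0 p01 p02
  rw [c1] at q1 p01 p12
  rw [c2] at q2 p02 p12
  have hd : X ^ (N + 1 - 5) * (X - 1) ^ (N + 1 - 4) * (X + 1) ^ (N + 1 - 4) * Q ^ 2 ∣ H := by
    refine IsCoprime.mul_dvd ?_ (IsCoprime.mul_dvd ?_ (IsCoprime.mul_dvd ?_ d0 d1) d2) hdvd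
    · exact IsCoprime.mul_left (IsCoprime.mul_left q0.pow q1.pow) q2.pow
    · exact IsCoprime.mul_left p02.pow p12.pow
    · exact p01.pow
  have hQ' : Q ≠ 0 := by
    rintro rfl
    simp at hQ0
  have n0 : X ≠ 0 := Polynomial.X_ne_zero
  have n1 : X - 1 ≠ 0 := c1 ▸ Polynomial.X_sub_C_ne_zero 1
  have n2 : X + 1 ≠ 0 := c2 ▸ Polynomial.X_sub_C_ne_zero (-1)
  have e0 : X.natDegree = 1 := Polynomial.natDegree_X
  have e1 : (X - 1).natDegree = 1 := c1 ▸ Polynomial.natDegree_X_sub_C 1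
  have e2 : (X + 1).natDegree = 1 := c2 ▸ Polynomial.natDegree_X_sub_C (-1)
  have hdeg : 3 * N + 6 ≤ H.natDegree := by
    have := Polynomial.natDegree_le_of_dvd hd hH
    rw [Polynomial.natDegree_mul (by positivity) (by positivity),
      Polynomial.natDegree_mul (by positivity) (by positivity),
      Polynomial.natDegree_mul (by positivity) (by positivity), Polynomial.natDegree_pow,
      Polynomial.natDegree_pow, Polynomial.natDegree_pow, Polynomial.natDegree_pow, e0, e1, e2,
      hQ] at this
    omega
  have hw : H.natDegree + 2 ≤ (quotNumerator H (X ^ 3 - X) N).natDegree :=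
    natDegree_quotNumerator rfl (by omega)
  have hw0 : quotNumerator H (X ^ 3 - X) N ≠ 0 := by
    intro h0
    rw [h0] at hw
    simp at hw
  have h2 := congrArg Polynomial.natDegree h
  rw [show (X ^ 2 - 1) ^ 4 = (X - 1) ^ 4 * (X + 1) ^ 4 by ring] at h2
  have h3 : (M * (X ^ 3 - X) ^ (N + 1)).natDegree ≤ 16 + (N + 1) * 3 := by
    refine Polynomial.natDegree_mul_le.trans (add_le_add hM ?_)
    refine Polynomial.natDegree_pow_le.trans (Nat.mul_le_mul_left _ ?_)
    rw [hX]
    compute_degree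
  rw [← h2, Polynomial.natDegree_mul (pow_ne_zero _ n0) (mul_ne_zero (mul_ne_zero (pow_ne_zero _ n1)
      (pow_ne_zero _ n2)) hw0),
    Polynomial.natDegree_mul (mul_ne_zero (pow_ne_zero _ n1) (pow_ne_zero _ n2)) hw0,
    Polynomial.natDegree_mul (pow_ne_zero _ n1) (pow_ne_zero _ n2), Polynomial.natDegree_pow,
    Polynomial.natDegree_pow, Polynomial.natDegree_pow, e0, e1, e2] at h3
  omega

end Wronskian

/-! # Linear independence of `1, x₁, x₂, x₃, x₁²` modulo divergences -/

section Independence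

namespace ConicParameter

variable {E : Type*} [CommRing E] [Algebra ℂ E] (π : ConicParameter E) (κ α β γ : ℂ)

theorem sq_sub_one_mul_s : (π.v ^ 2 - 1) * π.s = π.v := by
  linear_combination π.v * π.mul_s + π.s * π.mul_w

theorem v_mul_add : π.v * (π.v + π.w) = π.v ^ 2 + 1 := by
  linear_combination π.mul_w

/-- The elements of `E` that are rational functions of `v` with poles at `0, ±1, ∞`. -/
def rationalSubalgebra : Subalgebra ℂ E where
  carrier := {x | ∃ (n : ℕ) (P : Polynomial ℂ), (π.v ^ 3 - π.v) ^ n * x = Polynomial.aeval π.v P}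
  mul_mem' := by
    rintro x y ⟨n, P, hP⟩ ⟨m, Q, hQ⟩
    refine ⟨n + m, P * Q, ?_⟩
    rw [map_mul, ← hP, ← hQ]
    ring
  add_mem' := by
    rintro x y ⟨n, P, hP⟩ ⟨m, Q, hQ⟩
    refine ⟨n + m, (Polynomial.X ^ 3 - Polynomial.X) ^ m * P +
      (Polynomial.X ^ 3 - Polynomial.X) ^ n * Q, ?_⟩
    simp only [map_add, map_mul, map_pow, map_sub, Polynomial.aeval_X]
    rw [← hP, ← hQ]
    ring
  algebraMap_mem' a := ⟨0, Polynomial.C a, by simp⟩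

theorem mem_rationalSubalgebra {x : E} : x ∈ π.rationalSubalgebra ↔
    ∃ (n : ℕ) (P : Polynomial ℂ), (π.v ^ 3 - π.v) ^ n * x = Polynomial.aeval π.v P := Iff.rfl

theorem v_mem : π.v ∈ π.rationalSubalgebra := ⟨0, Polynomial.X, by simp⟩

theorem w_mem : π.w ∈ π.rationalSubalgebra := by
  refine ⟨1, Polynomial.X ^ 2 - 1, ?_⟩
  simp only [map_sub, map_pow, Polynomial.aeval_X, map_one]
  linear_combination (π.v ^ 2 - 1) * π.mul_w

theorem s_mem : π.s ∈ π.rationalSubalgebra := by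
  refine ⟨1, Polynomial.X ^ 2, ?_⟩
  simp only [map_pow, Polynomial.aeval_X]
  linear_combination π.v * π.sq_sub_one_mul_s

theorem center₁_mem : π.center₁ β γ ∈ π.rationalSubalgebra :=
  neg_mem (mul_mem (pow_mem π.s_mem _) (sub_mem (mul_mem (ofNat_mem _ 2)
    (Subalgebra.algebraMap_mem _ _))
    (mul_mem (add_mem π.v_mem π.w_mem) (Subalgebra.algebraMap_mem _ _))))

theorem center₂_mem : π.center₂ β γ ∈ π.rationalSubalgebra :=
  neg_mem (mul_mem (pow_mem π.s_mem _) (sub_mem (mul_mem (ofNat_mem _ 2)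
    (Subalgebra.algebraMap_mem _ _))
    (mul_mem (add_mem π.v_mem π.w_mem) (Subalgebra.algebraMap_mem _ _))))

theorem radius_mem : π.radius κ α β γ ∈ π.rationalSubalgebra := by
  have hz := add_mem π.v_mem π.w_mem
  have hA : ∀ a : ℂ, algebraMap ℂ E a ∈ π.rationalSubalgebra := Subalgebra.algebraMap_mem _
  exact add_mem (sub_mem (add_mem (hA _) (mul_mem (hA _) hz)) (pow_mem hz 2))
    (mul_mem (hA _) (add_mem (mul_mem (hA _) (π.center₁_mem β γ))
      (mul_mem (hA _) (π.center₂_mem β γ))))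

theorem momentFunctional_map_mem (S : Subalgebra ℂ E) {w : ℕ → ℕ → E} (hw : ∀ a b, w a b ∈ S)
    {p : MvPolynomial (Fin 2) E} (hp : p ∈ (mapAlgHom (σ := Fin 2) S.val).range) :
    momentFunctional w p ∈ S := by
  obtain ⟨q, rfl⟩ := hp
  induction q using induction_on_C_mul_pow with
  | mul_pow e a b =>
    have : mapAlgHom S.val (C e * (X 0 ^ a * X 1 ^ b) : MvPolynomial (Fin 2) S) =
        C (e : E) * (X 0 ^ a * X 1 ^ b) := by simp
    change momentFunctional w (mapAlgHom S.val _) ∈ S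
    rw [this, momentFunctional_apply]
    exact mul_mem e.2 (hw a b)
  | add p q hp hq =>
    rw [map_add, map_add]
    exact add_mem hp hq

theorem split_mem (p : MvPolynomial (Fin 3) ℂ) :
    π.split β γ p ∈ (mapAlgHom (σ := Fin 2) π.rationalSubalgebra.val).range := by
  have hC : ∀ e ∈ π.rationalSubalgebra,
      (C e : MvPolynomial (Fin 2) E) ∈ (mapAlgHom (σ := Fin 2) π.rationalSubalgebra.val).range :=
    fun e he => ⟨C ⟨e, he⟩, by simp⟩
  have hX : ∀ i, (X i : MvPolynomial (Fin 2) E) ∈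
      (mapAlgHom (σ := Fin 2) π.rationalSubalgebra.val).range := fun i => ⟨X i, by simp⟩
  induction p using MvPolynomial.induction_on with
  | C a => rw [split_C]; exact hC _ (Subalgebra.algebraMap_mem _ _)
  | add p q hp hq => rw [map_add]; exact add_mem hp hq
  | mul_X p i hp =>
    rw [map_mul]
    refine mul_mem hp ?_
    fin_cases i
    · simp only [Fin.zero_eta, split_X0]
      exact hC _ (add_mem π.v_mem π.w_mem)
    · simp only [Fin.mk_one, split_X1]
      exact add_mem (hC _ (π.center₁_mem β γ)) (mul_mem (hC _ π.s_mem)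
        (sub_mem (mul_mem (hC _ π.v_mem) (hX 1)) (mul_mem (hC _ π.w_mem) (hX 0))))
    · simp only [Fin.reduceFinMk, split_X2]
      exact add_mem (hC _ (π.center₂_mem β γ)) (mul_mem (hC _ π.s_mem) (sub_mem (hX 0) (hX 1)))

/-- This confines the poles of the primitive `R` to `0, ±1, ∞`, so that its zeros and poles can be
counted with polynomials. -/
theorem conicWeightedMean_split_mem (p : MvPolynomial (Fin 3) ℂ) :
    conicWeightedMean (π.radius κ α β γ) (π.split β γ p) ∈ π.rationalSubalgebra := by
  refine momentFunctional_map_mem _ (fun a b => ?_) (π.split_mem β γ p)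
  split_ifs
  · exact mul_mem (mul_mem (Subalgebra.algebraMap_mem _ _) (Subalgebra.algebraMap_mem _ _))
      (pow_mem (π.radius_mem κ α β γ) _)
  · exact zero_mem _

end ConicParameter

/-! ### Numerators in `v` and the generic case of independence -/

/-- The numerator of the radius of the conic over `x₁ = v + v⁻¹`. -/
noncomputable def radiusNum (κ α β γ : ℂ) : Polynomial ℂ :=
  (Polynomial.C κ * Polynomial.X ^ 2 + Polynomial.C α * (Polynomial.X * (Polynomial.X ^ 2 + 1)) -
    (Polynomial.X ^ 2 + 1) ^ 2) * (Polynomial.X ^ 2 - 1) ^ 2 -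
  Polynomial.C (β ^ 2 + γ ^ 2) * Polynomial.X ^ 4 +
  Polynomial.C (β * γ) * (Polynomial.X ^ 3 * (Polynomial.X ^ 2 + 1))

/-- The numerator of the mean of a combination of the basis polynomials. -/
noncomputable def meanNum (β γ : ℂ) (a : Fin 5 → ℂ) : Polynomial ℂ :=
  (Polynomial.C (a 0) * Polynomial.X ^ 2 +
    Polynomial.C (a 1) * (Polynomial.X * (Polynomial.X ^ 2 + 1)) +
    Polynomial.C (a 4) * (Polynomial.X ^ 2 + 1) ^ 2) * (Polynomial.X ^ 2 - 1) ^ 2 -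
  Polynomial.C (a 2) * (Polynomial.C (2 * β) * Polynomial.X ^ 4 -
    Polynomial.C γ * (Polynomial.X ^ 3 * (Polynomial.X ^ 2 + 1))) -
  Polynomial.C (a 3) * (Polynomial.C (2 * γ) * Polynomial.X ^ 4 -
    Polynomial.C β * (Polynomial.X ^ 3 * (Polynomial.X ^ 2 + 1)))

theorem natDegree_radiusNum (κ α β γ : ℂ) : (radiusNum κ α β γ).natDegree = 8 := by
  rw [radiusNum]
  compute_degree!

theorem natDegree_meanNum_le (β γ : ℂ) (a : Fin 5 → ℂ) : (meanNum β γ a).natDegree ≤ 8 := by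
  rw [meanNum]
  compute_degree!

/-- At `v = ±1` only the `a 2` and `a 3` terms survive, with factors `β ∓ γ`; the rest is a
combination of `1, x₁, x₁²`. -/
theorem eq_zero_of_meanNum_eq_zero {β γ : ℂ} (hβγ : β ^ 2 ≠ γ ^ 2) {a : Fin 5 → ℂ}
    (h : meanNum β γ a = 0) : a = 0 := by
  have hne : (β - γ) * (β + γ) ≠ 0 := fun h => hβγ (by linear_combination h)
  have h1 : (β - γ) * (a 2 - a 3) = 0 := by
    have := congrArg (Polynomial.eval 1) h
    simp [meanNum] at this
    linear_combination (-1 / 2) * this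
  have h2 : (β + γ) * (a 2 + a 3) = 0 := by
    have := congrArg (Polynomial.eval (-1)) h
    simp [meanNum] at this
    linear_combination (-1 / 2) * this
  have h1' := (mul_eq_zero.1 h1).resolve_left (left_ne_zero_of_mul hne)
  have h2' := (mul_eq_zero.1 h2).resolve_left (right_ne_zero_of_mul hne)
  have ha2 : a 2 = 0 := by linear_combination (h1' + h2') / 2
  have ha3 : a 3 = 0 := by linear_combination (h2' - h1') / 2
  have h3 : Polynomial.C (a 0) * Polynomial.X ^ 2 +
      Polynomial.C (a 1) * (Polynomial.X * (Polynomial.X ^ 2 + 1)) +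
      Polynomial.C (a 4) * (Polynomial.X ^ 2 + 1) ^ 2 = 0 := by
    rw [meanNum, ha2, ha3, map_zero, zero_mul, zero_mul, sub_zero, sub_zero] at h
    refine (mul_eq_zero.1 h).resolve_right (pow_ne_zero _ ?_)
    exact Polynomial.X_pow_sub_C_ne_zero two_pos (1 : ℂ)
  have ha4 : a 4 = 0 := by
    simpa using congrArg (Polynomial.eval 0) h3
  have e1 := congrArg (Polynomial.eval 1) h3
  have e2 := congrArg (Polynomial.eval (-1)) h3
  simp [ha4] at e1 e2
  have ha0 : a 0 = 0 := by linear_combination (e1 + e2) / 2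
  have ha1 : a 1 = 0 := by linear_combination (e1 - e2) / 4
  funext j
  fin_cases j <;> assumption

theorem ConicParameter.eq_zero_of_sum_basisPoly_eq {E : Type*} [CommRing E] [Algebra ℂ E]
    (π : ConicParameter E) (hπ : Function.Injective (Polynomial.aeval π.v : Polynomial ℂ →ₐ[ℂ] E))
    {κ α β γ : ℂ} (hβγ : β ^ 2 ≠ γ ^ 2) {a : Fin 5 → ℂ} {h : Fin 3 → MvPolynomial (Fin 3) ℂ}
    (hah : ∑ j, a j • basisPoly ℂ j = divMul (cubic κ α β γ) h) : a = 0 := by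
  have key := π.radius_mul_conicMean_divMul κ α β γ h
  rw [← hah, conicMean_split_basisPoly] at key
  obtain ⟨n, P, hP⟩ := π.mem_rationalSubalgebra.1 (π.conicWeightedMean_split_mem κ α β γ (h 0))
  have hz := π.v_mul_add
  have hs := π.sq_sub_one_mul_s
  have hF : Polynomial.aeval π.v (radiusNum κ α β γ) =
      π.v ^ 2 * (π.v ^ 2 - 1) ^ 2 * π.radius κ α β γ := by
    have h2 : 2 * algebraMap ℂ E (1 / 2) = 1 := by
      rw [← map_ofNat (algebraMap ℂ E) 2, ← map_mul]
      norm_num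
    simp only [radiusNum, ConicParameter.radius, ConicParameter.center₁, ConicParameter.center₂,
      map_add, map_sub, map_mul, map_pow, Polynomial.aeval_X, Polynomial.aeval_C, map_one]
    generalize π.v + π.w = z at *
    generalize algebraMap ℂ E (1 / 2) = i at *
    generalize algebraMap ℂ E κ = k, algebraMap ℂ E α = l, algebraMap ℂ E β = m,
      algebraMap ℂ E γ = r
    generalize π.v = v, π.s = s at *
    linear_combination ((v ^ 2 - 1) ^ 2 * (v * z + v ^ 2 + 1) - (v ^ 2 - 1) ^ 2 * l * v -
      m * r * v ^ 3) * hz + v ^ 2 * (m ^ 2 + r ^ 2 - z * m * r) * (((v ^ 2 - 1) * s) ^ 2 * h2 +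
      ((v ^ 2 - 1) * s + v) * hs)
  have hM : Polynomial.aeval π.v (meanNum β γ a) = π.v ^ 2 * (π.v ^ 2 - 1) ^ 2 *
      (algebraMap ℂ E (a 0) + algebraMap ℂ E (a 1) * (π.v + π.w) +
        algebraMap ℂ E (a 2) * π.center₁ β γ + algebraMap ℂ E (a 3) * π.center₂ β γ +
        algebraMap ℂ E (a 4) * (π.v + π.w) ^ 2) := by
    simp only [meanNum, ConicParameter.center₁, ConicParameter.center₂,
      map_add, map_sub, map_mul, map_pow, Polynomial.aeval_X, Polynomial.aeval_C, map_one,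
      map_ofNat]
    generalize π.v + π.w = z at *
    generalize algebraMap ℂ E (a 0) = a0, algebraMap ℂ E (a 1) = a1, algebraMap ℂ E (a 2) = a2,
      algebraMap ℂ E (a 3) = a3, algebraMap ℂ E (a 4) = a4, algebraMap ℂ E β = m,
      algebraMap ℂ E γ = r
    generalize π.v = v, π.s = s at *
    linear_combination ((v ^ 2 - 1) ^ 2 * (-(a1 * v) - a4 * (v * z + v ^ 2 + 1)) -
      a2 * r * v ^ 3 - a3 * m * v ^ 3) * hz + (a2 * (2 * m - z * r) + a3 * (2 * r - z * m)) *
      v ^ 2 * ((v ^ 2 - 1) * s + v) * hs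
  set c := π.radius κ α β γ with hc
  set k := conicWeightedMean c (π.split β γ (h 0)) with hk
  set F := radiusNum κ α β γ with hFdef
  set M := meanNum β γ a with hMdef
  -- `H` is the numerator of `R = s c² k` over `T ^ (n + 5)`: `F²` contributes `T⁴` after absorbing
  -- `v⁴(v² - 1)⁴`, and `v² = T s` gives the last factor.
  set H : Polynomial ℂ := Polynomial.X ^ 2 * F ^ 2 * P with hH
  set T : Polynomial ℂ := Polynomial.X ^ 3 - Polynomial.X with hT
  have hTv : Polynomial.aeval π.v T = π.v ^ 3 - π.v := by simp [hT]
  have hHv : Polynomial.aeval π.v H = π.s * c ^ 2 * k * Polynomial.aeval π.v T ^ (n + 5) := by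
    simp only [hH, map_mul, map_pow, Polynomial.aeval_X, hF, ← hP, hTv]
    linear_combination (-(π.v * (π.v ^ 3 - π.v) ^ (n + 4) * c ^ 2 * k)) * hs
  have hDH : π.v * Polynomial.aeval π.v (Polynomial.derivative H) =
      π.D (Polynomial.aeval π.v H) := by
    rw [Derivation.map_aeval, π.D_v, smul_eq_mul, mul_comm]
  have hDT : π.v * Polynomial.aeval π.v (Polynomial.derivative T) =
      π.D (Polynomial.aeval π.v T) := by
    rw [Derivation.map_aeval, π.D_v, smul_eq_mul, mul_comm]
  rw [hHv, Derivation.leibniz, Derivation.leibniz_pow, ← hDT, ← key, smul_eq_mul, smul_eq_mul,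
    smul_eq_mul, nsmul_eq_mul, show n + 5 - 1 = n + 4 from rfl] at hDH
  have hrel : Polynomial.X ^ 5 * ((Polynomial.X ^ 2 - 1) ^ 4 * quotNumerator H T (n + 5)) =
      (F * M) * T ^ (n + 5 + 1) := by
    apply hπ
    simp only [quotNumerator, map_mul, map_sub, map_pow, Polynomial.aeval_X, map_one, map_natCast,
      hF, hM]
    rw [hHv]
    linear_combination π.v ^ 4 * (π.v ^ 2 - 1) ^ 4 * Polynomial.aeval π.v T * hDH
  have hF0 : F.eval 0 ≠ 0 := by simp [hFdef, radiusNum]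
  -- `F(±1) = -(β ∓ γ)²`: here the condition `β² ≠ γ²` keeps the zeros of `F` away from the poles.
  have hF1 : F.eval 1 ≠ 0 := by
    intro h0
    simp [hFdef, radiusNum] at h0
    have : (β - γ) ^ 2 = 0 := by linear_combination -h0
    exact hβγ (by rw [sub_eq_zero.1 (pow_eq_zero_iff two_ne_zero |>.1 this)])
  have hF2 : F.eval (-1) ≠ 0 := by
    intro h0
    simp [hFdef, radiusNum] at h0
    have : (β + γ) ^ 2 = 0 := by linear_combination -h0
    exact hβγ (by rw [eq_neg_of_add_eq_zero_left (pow_eq_zero_iff two_ne_zero |>.1 this), neg_sq])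
  have hdeg : (F * M).natDegree ≤ 16 := Polynomial.natDegree_mul_le.trans
    (add_le_add (natDegree_radiusNum κ α β γ).le (natDegree_meanNum_le β γ a))
  have hH0 : H = 0 := eq_zero_of_quotNumerator_eq (by omega) hdeg (natDegree_radiusNum κ α β γ)
    hF0 hF1 hF2 ⟨Polynomial.X ^ 2 * P, by rw [hH]; ring⟩ hrel
  rw [hH0] at hrel
  have hT0 : T ≠ 0 := by
    intro h0
    have := congrArg (Polynomial.eval 2) h0
    norm_num [hT] at this
  have hFne : F ≠ 0 := by
    intro h0
    simp [h0] at hF0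
  have hM0 : M = 0 := by
    simpa [quotNumerator, hFne, hT0] using hrel.symm
  exact eq_zero_of_meanNum_eq_zero hβγ hM0

/-! ### A concrete parameter and deformation to arbitrary coefficients -/

/-- The conic parameter `v = 2 + t` in the ring of power series in `t`. -/
noncomputable def powerSeriesParameter : ConicParameter (PowerSeries ℂ) where
  v := PowerSeries.X + PowerSeries.C 2
  w := (PowerSeries.X + PowerSeries.C 2)⁻¹
  s := (PowerSeries.X + PowerSeries.C 2 - (PowerSeries.X + PowerSeries.C 2)⁻¹)⁻¹
  D := (PowerSeries.X + PowerSeries.C 2 : PowerSeries ℂ) • PowerSeries.derivative ℂ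
  mul_w := PowerSeries.mul_inv_cancel _ (by simp)
  mul_s := PowerSeries.mul_inv_cancel _ (by simp; norm_num)
  D_v := by simp

/-- The base point `2` avoids `0, ±1`, so `v` and `v - v⁻¹` are units, while `v` stays
transcendental: translating back by `2` recovers the polynomial. -/
theorem aeval_powerSeriesParameter_injective : Function.Injective
    (Polynomial.aeval powerSeriesParameter.v : Polynomial ℂ →ₐ[ℂ] PowerSeries ℂ) := by
  have h : ∀ P : Polynomial ℂ, Polynomial.aeval powerSeriesParameter.v P =
      ((P.comp (Polynomial.X + Polynomial.C 2) : Polynomial ℂ) : PowerSeries ℂ) := by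
    intro P
    induction P using Polynomial.induction_on' with
    | add P Q hP hQ => simp only [map_add, Polynomial.add_comp, Polynomial.coe_add, hP, hQ]
    | monomial n a =>
      rw [Polynomial.aeval_monomial, Polynomial.monomial_comp, Polynomial.coe_mul,
        Polynomial.coe_pow, Polynomial.coe_add, Polynomial.coe_X, Polynomial.coe_C,
        Polynomial.coe_C]
      rfl
  intro P Q hPQ
  rw [h, h, Polynomial.coe_inj] at hPQ
  have := congrArg (fun R => Polynomial.comp R (Polynomial.X - Polynomial.C 2)) hPQ
  simpa [Polynomial.comp_assoc] using this

/-- The five basis polynomials are independent modulo divergences if `β² ≠ γ²`. -/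
theorem eq_zero_of_sum_basisPoly_eq_of_sq_ne {κ α β γ : ℂ} (hβγ : β ^ 2 ≠ γ ^ 2) {a : Fin 5 → ℂ}
    (h : ∑ j, a j • basisPoly ℂ j ∈ divSubmodule (cubic κ α β γ)) : a = 0 := by
  obtain ⟨g, hg⟩ := h
  exact powerSeriesParameter.eq_zero_of_sum_basisPoly_eq aeval_powerSeriesParameter_injective hβγ
    hg.symm

theorem map_divMul {k l : Type*} [CommRing k] [CommRing l] (φ : k →+* l)
    (u : MvPolynomial (Fin 3) k) (h : Fin 3 → MvPolynomial (Fin 3) k) :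
    map φ (divMul u h) = divMul (map φ u) fun i => map φ (h i) := by
  rw [divMul_apply, divMul_apply, map_sum]
  refine Finset.sum_congr rfl fun i _ => ?_
  rw [← pderiv_map, map_mul]

theorem map_cubic {k l : Type*} [CommRing k] [CommRing l] (φ : k →+* l) (κ α β γ : k) :
    map φ (cubic κ α β γ) = cubic (φ κ) (φ α) (φ β) (φ γ) := by
  simp [cubic]

theorem map_sum_basisPoly {k l : Type*} [CommRing k] [CommRing l] (φ : k →+* l) (a : Fin 5 → k) :
    map φ (∑ j, a j • basisPoly k j) = ∑ j, φ (a j) • basisPoly l j := by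
  rw [map_sum]
  refine Finset.sum_congr rfl fun j _ => ?_
  rw [smul_eq_C_mul, smul_eq_C_mul, map_mul, map_C]
  congr 1
  fin_cases j <;> simp [basisPoly]

/-- The five basis polynomials are independent modulo divergences: a relation deforms, along the
family `β + τ`, to a relation with coefficients polynomial in `τ`. -/
theorem eq_zero_of_sum_basisPoly_mem {κ α β γ : ℂ} {a : Fin 5 → ℂ}
    (h : ∑ j, a j • basisPoly ℂ j ∈ divSubmodule (cubic κ α β γ)) : a = 0 := by
  obtain ⟨g, hg⟩ := h
  let ι : ℂ →+* Polynomial ℂ := Polynomial.C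
  let g' : Fin 3 → MvPolynomial (Fin 3) (Polynomial ℂ) := fun i => map ι (g i)
  let u : MvPolynomial (Fin 3) (Polynomial ℂ) := cubic (ι κ) (ι α) (ι β + Polynomial.X) (ι γ)
  have hu : u = map ι (cubic κ α β γ) + (Polynomial.X : Polynomial ℂ) • X 1 := by
    rw [map_cubic, smul_eq_C_mul]
    simp only [u, cubic, map_add]
    ring
  -- The error `τ div(x₂ g)` from replacing `β` by `β + τ` is itself reduced over `ℂ[τ]`, which
  -- turns the relation into one with coefficients `a j + τ c j`.
  obtain ⟨c, h', hc⟩ := exists_basisPoly_add_divMul (ι κ) (ι α) (ι β + Polynomial.X) (ι γ)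
    (divMul (X 1) g')
  have hsplit : divMul u g' = map ι (divMul (cubic κ α β γ) g) +
      (Polynomial.X : Polynomial ℂ) • divMul (X 1) g' := by
    rw [map_divMul, hu, divMul_apply, divMul_apply, divMul_apply, Finset.smul_sum,
      ← Finset.sum_add_distrib]
    refine Finset.sum_congr rfl fun i _ => ?_
    rw [add_mul, map_add, smul_mul_assoc, Derivation.map_smul]
  have hrel : ∑ j, (ι (a j) + Polynomial.X * c j) • basisPoly (Polynomial ℂ) j =
      divMul u (g' - Polynomial.X (R := ℂ) • h') := by
    rw [map_sub, map_smul, hsplit, hg, map_sum_basisPoly, hc, smul_add, Finset.smul_sum]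
    simp only [add_smul, mul_smul, Finset.sum_add_distrib]
    abel
  have hev : ∀ t : ℂ, (β + t) ^ 2 ≠ γ ^ 2 → ∀ j, (ι (a j) + Polynomial.X * c j).eval t = 0 := by
    intro t ht j
    have h1 := congrArg (map (Polynomial.evalRingHom t)) hrel
    rw [map_sum_basisPoly, map_divMul, map_cubic] at h1
    have h2 := eq_zero_of_sum_basisPoly_eq_of_sq_ne (γ := γ) (β := β + t) ht ⟨_, by
      simpa [ι] using h1.symm⟩
    simpa [ι] using congrFun h2 j
  -- The deformed coefficients vanish for all but two values of `τ`, hence identically; `τ = 0`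
  -- gives back `a`.
  have hinf : {t : ℂ | (β + t) ^ 2 ≠ γ ^ 2}.Infinite := by
    refine (Set.toFinite ({γ - β, -γ - β} : Set ℂ)).infinite_compl.mono ?_
    intro t ht h
    apply ht
    rcases sq_eq_sq_iff_eq_or_eq_neg.1 h with h | h
    · exact Or.inl (by linear_combination h)
    · exact Or.inr (by rw [Set.mem_singleton_iff]; linear_combination h)
  funext j
  have h0 : ι (a j) + Polynomial.X * c j = 0 :=
    Polynomial.eq_zero_of_infinite_isRoot _ (hinf.mono fun t ht => hev t ht j)
  simpa [ι] using congrArg (Polynomial.eval 0) h0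

end Independence

/-! # The second de Rham cohomology of `M_b` -/

/-- `d(f x₁ dx₂∧dx₃)` has coefficient `∂₁(f x₁)`, so the constants are the exponents of `x₁` in `f
x₁`. -/
theorem volCoeff_polyExtDeriv_basisForm (j : Fin 5) :
    volCoeff (polyExtDeriv 3 2 (basisForm j)) = (![1, 2, 1, 1, 3] j : ℂ) • basisPoly ℂ j := by
  have h12 : (dxForm ![1, 2] : PolyForm 3 2) ![coordVec 1, coordVec 2] = 1 := by
    simp [dxForm_apply, Matrix.det_fin_two]
  have h02 : (dxForm ![1, 2] : PolyForm 3 2) ![coordVec 0, coordVec 2] = 0 := by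
    simp [dxForm_apply, Matrix.det_fin_two]
  have h01 : (dxForm ![1, 2] : PolyForm 3 2) ![coordVec 0, coordVec 1] = 0 := by
    simp [dxForm_apply, Matrix.det_fin_two]
  have key : ∀ f : MvPolynomial (Fin 3) ℂ,
      volCoeff (polyExtDeriv 3 2 (f • ((X 0 : MvPolynomial (Fin 3) ℂ) • dxForm ![1, 2]))) =
        pderiv 0 (f * X 0) := by
    intro f
    rw [volCoeff_polyExtDeriv]
    simp only [AlternatingMap.smul_apply, smul_eq_mul, h12, h02, h01, mul_zero, mul_one, map_zero,
      sub_zero, add_zero]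
  have c2 : (C 2 : MvPolynomial (Fin 3) ℂ) = 2 := map_ofNat C 2
  have c3 : (C 3 : MvPolynomial (Fin 3) ℂ) = 3 := map_ofNat C 3
  fin_cases j
  · refine (key 1).trans ?_
    simp [basisPoly]
  · simp [basisForm, key, basisPoly, pderiv_X, smul_eq_C_mul, c2]
    ring
  · simp [basisForm, key, basisPoly, pderiv_X]
  · simp [basisForm, key, basisPoly, pderiv_X]
  · simp [basisForm, key, basisPoly, pderiv_X, smul_eq_C_mul, c3]
    ring

theorem theorem7p3 (b : Fin 4 → ℂ) :
    (Algebra.Smooth ℂ (FourHoledRing b) ↔ psi4 b ≠ 0) ∧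
    (Algebra.Smooth ℂ (FourHoledRing b) →
      Module.finrank ℂ (DeRhamCohomology (fourHoledIdeal b) 2) = 5 ∧
      ∃ B : Module.Basis (Fin 5) ℂ (DeRhamCohomology (fourHoledIdeal b) 2),
        ∀ j, ∃ h : restrictForm (fourHoledIdeal b) 2 (basisForm j) ∈
            closedForms (fourHoledIdeal b) 2,
          B j = deRhamClass (fourHoledIdeal b) 2
            ⟨restrictForm (fourHoledIdeal b) 2 (basisForm j), h⟩) := by
  refine ⟨smooth_fourHoledRing_iff b, fun hsm => ?_⟩
  have hne : ∀ j, (![1, 2, 1, 1, 3] j : ℂ) ≠ 0 := fun j => by fin_cases j <;> simp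
  have hu : fourHoledPoly b ≠ 0 := fourHoledPoly_eq_cubic b ▸ cubic_ne_zero _ _ _ _
  -- Smoothness enters the cohomology only through this unit relation, which makes all 2-forms
  -- closed.
  obtain ⟨r, a, hra⟩ := (formallySmooth_quotient_span_iff hu).1 hsm.formallySmooth
  obtain ⟨B, hB⟩ := exists_deRham_basis hra basisForm
    (by
      intro c hc
      simp only [volCoeff_polyExtDeriv_basisForm, smul_smul, fourHoledPoly_eq_cubic] at hc
      have h0 := eq_zero_of_sum_basisPoly_mem hc
      funext j
      exact (mul_eq_zero.1 (congrFun h0 j)).resolve_right (hne j))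
    (by
      intro p
      obtain ⟨c, h, hp⟩ := exists_basisPoly_add_divMul
        (4 - b 0 ^ 2 - b 1 ^ 2 - b 2 ^ 2 - b 0 * b 1 * b 2 * b 3 - b 3 ^ 2)
        (b 0 * b 1 + b 2 * b 3) (b 0 * b 2 + b 1 * b 3) (b 1 * b 2 + b 0 * b 3) p
      refine ⟨fun j => c j / ![1, 2, 1, 1, 3] j, h, ?_⟩
      simp only [volCoeff_polyExtDeriv_basisForm, smul_smul, div_mul_cancel₀ _ (hne _),
        fourHoledPoly_eq_cubic]
      rw [hp, add_sub_cancel_left])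
  exact ⟨(Module.finrank_eq_card_basis B).trans (Fintype.card_fin 5), B, hB⟩
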